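/- Write $\bar z=1/z$ and $\mathbb N=\{0,1,2,\dots\}$. Let $\mathcal S\subset\{-1,0,1\}^3$ be a $(2,1)$-Hadamard step set, that is, $$\mathcal S=(\mathcal U\times\{0\})\cup(\mathcal V\times\mathcal T)$$ with $\mathcal U\subset\{-1,0,1\}^2\setminus\{(0,0)\}$, $\mathcal V\subset\{-1,0,1\}^2$ and $\mathcal T\subset\{-1,0,1\}\setminus\{0\}$. All walks start from the origin. Let $O(x,y,z;t)$ be the generating function of walks with steps in $\mathcal S$ confined to $\mathbb N^3$, where $t$ counts the length (number of steps) and $x,y,z$ record the coordinates of the endpoint. Let $C_1(x,y,v;t)$ be the generating function of coloured $(\mathcal U,\mathcal V)$-walks in the quadrant: these are the walks confined to $\mathbb N^2$ with steps in $\mathcal U\cup\mathcal V$, each step being coloured black or white, such that all steps of $\mathcal U\setminus\mathcal V$ are white and all steps of $\mathcal V\setminus\mathcal U$ are black (steps of $\mathcal U\cap\mathcal V$ may have either colour); $t$ counts the length, $v$ the number of black steps, and $x,y$ record the coordinates of the endpoint. A series $F$ in the variables $u_1,\dots,u_m$ is called D-finite (in all its variables) if, for each $i$ separately, the vector space over $\mathbb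 Q(u_1,\dots,u_m)$ spanned by the iterated derivatives $\partial^kF/\partial u_i^k$ ($k\ge 0$) has finite dimension. 1. If $C_1(x,y,v;t)$ is D-finite (in $x,y,v,t$), then $O(x,y,z;t)$ is D-finite (in $x,y,z,t$). 2. If moreover $T(z):=\sum_{k\in\mathcal T}z^k$ is equal to $z+\bar z$ then, whether or not $C_1$ is D-finite, $$O(x,y,z;t)=[z^{\ge 0}]\,(1-\bar z^2)\,Q(x,y,z;t),$$ where $Q(x,y,z;t)$ is the generating function of walks with steps in $\mathcal S$ confined to $\mathbb N^2\times\mathbb Z$, counted in the same way by the length and the coordinates of the endpoint, and $[z^{\ge 0}]$ extracts from a power series in $t$ with Laurent polynomial coefficients the monomials with a nonnegative exponent of $z$. -/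

import Mathlib

noncomputable section

namespace LatticeWalks

/-! ### Series in `t` with Laurent polynomial coefficients -/

/-- Laurent polynomials over `ℚ` in the `d` variables `x₀, …, x_{d-1}`;
`AddMonoidAlgebra.single p c` is `c x₀ ^ p 0 ⋯ x_{d-1} ^ p (d-1)`. -/
abbrev LaurentPoly (d : ℕ) : Type := AddMonoidAlgebra ℚ (Fin d → ℤ)

/-- Power series in `t` whose coefficients are Laurent polynomials in `x₀, …, x_{d-1}`. -/
abbrev WalkSeries (d : ℕ) : Type := PowerSeries (LaurentPoly d)

/-- The Laurent monomial `x ^ p`. -/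
def monom {d : ℕ} (p : Fin d → ℤ) : LaurentPoly d := AddMonoidAlgebra.single p 1

/-- The variables of a `WalkSeries d`: `some i` stands for `xᵢ`, and `none` for `t`. -/
def variableSeries {d : ℕ} : Option (Fin d) → WalkSeries d
  | none => PowerSeries.X
  | some i => PowerSeries.C (monom (Pi.single i 1))

/-- The polynomial ring `ℚ[x₀, …, x_{d-1}, t]`. -/
abbrev PolyRing (d : ℕ) : Type := MvPolynomial (Option (Fin d)) ℚ

/-- `WalkSeries d` as an algebra over `ℚ[x₀, …, x_{d-1}, t]`: each variable acts as itself. -/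
instance polyAlgebra (d : ℕ) : Algebra (PolyRing d) (WalkSeries d) :=
  (MvPolynomial.aeval (R := ℚ) (variableSeries (d := d))).toRingHom.toAlgebra

/-- The partial derivative `∂/∂xᵢ` of a Laurent polynomial. -/
def laurentDeriv {d : ℕ} (i : Fin d) (f : LaurentPoly d) : LaurentPoly d :=
  f.coeff.sum fun p c => AddMonoidAlgebra.single (p - Pi.single i 1) ((p i : ℚ) * c)

/-- The partial derivative with respect to one of the variables `xᵢ` or `t`. -/
def partialDeriv {d : ℕ} : Option (Fin d) → WalkSeries d → WalkSeries d
  | none => fun F => PowerSeries.derivative (LaurentPoly d) F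
  | some i => fun F => PowerSeries.mk fun n => laurentDeriv i (PowerSeries.coeff n F)

/-- `F` is D-finite in all its variables `x₀, …, x_{d-1}, t`: for each of them separately, the
vector space over `ℚ(x₀, …, x_{d-1}, t)` spanned by the iterated derivatives of `F` with respect
to this variable has finite dimension. The series are seen in the vector space obtained from
`WalkSeries d` by inverting the nonzero elements of `ℚ[x₀, …, x_{d-1}, t]`. -/
def IsDFinite {d : ℕ} (F : WalkSeries d) : Prop :=
  ∀ u : Option (Fin d),
    FiniteDimensional (FractionRing (PolyRing d))
      (Submodule.span (FractionRing (PolyRing d))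
        (Set.range fun m : ℕ =>
          LocalizedModule.mkLinearMap (nonZeroDivisors (PolyRing d)) (WalkSeries d)
            ((partialDeriv u)^[m] F)))

open Classical in
/-- The operator `[xᵢ^{≥ 0}]`: keep the monomials whose exponent of `xᵢ` is nonnegative. -/
def nonnegPart {d : ℕ} (i : Fin d) (F : WalkSeries d) : WalkSeries d :=
  PowerSeries.mk fun n =>
    AddMonoidAlgebra.ofCoeff ((PowerSeries.coeff n F).coeff.filter fun p => 0 ≤ p i)

/-! ### Walks -/

/-- The position, after `k` steps, of the walk from the origin with successive steps `w`. -/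
def position {d n : ℕ} (w : Fin n → Fin d → ℤ) (k : ℕ) : Fin d → ℤ :=
  ∑ i ∈ Finset.univ.filter (fun i : Fin n => (i : ℕ) < k), w i

/-- The walk with steps `w` stays in the region `R`. -/
def StaysIn {d n : ℕ} (R : Set (Fin d → ℤ)) (w : Fin n → Fin d → ℤ) : Prop :=
  ∀ k ≤ n, position w k ∈ R

/-- The region `ℕ^d`. -/
def orthant (d : ℕ) : Set (Fin d → ℤ) := {p | ∀ i, 0 ≤ p i}

/-- The region `ℕ² × ℤ`. -/
def quadrantTimesLine : Set (Fin 3 → ℤ) := {p | 0 ≤ p 0 ∧ 0 ≤ p 1}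

open Classical in
/-- The generating function of walks from the origin with steps in `S` that stay in `R`, counted
by the coordinates of the endpoint (`x₀, …, x_{d-1}`) and the length (`t`). -/
def walkSeries {d : ℕ} (S : Finset (Fin d → ℤ)) (R : Set (Fin d → ℤ)) : WalkSeries d :=
  PowerSeries.mk fun n =>
    ∑ w ∈ Fintype.piFinset (fun _ : Fin n => S) with StaysIn R w, monom (position w n)

/-- The characteristic polynomial `∑_{s ∈ S} x ^ s` of a set of steps. -/
def charPoly {d : ℕ} (S : Finset (Fin d → ℤ)) : LaurentPoly d := ∑ s ∈ S, monom s

/-- The two colours of steps: `Colour.black` and `Colour.white`. -/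
abbrev Colour : Type := Bool

/-- The colour black. -/
abbrev Colour.black : Colour := true

/-- The colour white. -/
abbrev Colour.white : Colour := false

open Classical in
/-- The coloured steps: elements of `U ∪ V` with a colour, where all steps of `U \ V` are white
and all steps of `V \ U` are black. -/
def colouredSteps {d : ℕ} (U V : Finset (Fin d → ℤ)) : Finset ((Fin d → ℤ) × Colour) :=
  ((U ∪ V) ×ˢ Finset.univ).filter fun a =>
    (a.1 ∈ U \ V → a.2 = Colour.white) ∧ (a.1 ∈ V \ U → a.2 = Colour.black)

/-- The number of black steps of a coloured walk. -/
def blackCount {d n : ℕ} (w : Fin n → (Fin d → ℤ) × Colour) : ℕ :=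
  (Finset.univ.filter fun i => (w i).2 = Colour.black).card

open Classical in
/-- The generating function of coloured `(U, V)`-walks confined to `ℕ^d`, counted by the
coordinates of the endpoint (`x₀, …, x_{d-1}`), the number of black steps (the last variable,
`v = x_d`) and the length (`t`). -/
def colouredSeries {d : ℕ} (U V : Finset (Fin d → ℤ)) : WalkSeries (d + 1) :=
  PowerSeries.mk fun n =>
    ∑ w ∈ Fintype.piFinset (fun _ : Fin n => colouredSteps U V) with
        StaysIn (orthant d) (fun i => (w i).1),
      monom (Fin.append (position (fun i => (w i).1) n) ![(blackCount w : ℤ)])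

/-! ### Hadamard models -/

/-- All coordinates of all steps of `S` are in `{-1, 0, 1}`. -/
def HasSmallSteps {d : ℕ} (S : Finset (Fin d → ℤ)) : Prop :=
  ∀ s ∈ S, ∀ i, s i = -1 ∨ s i = 0 ∨ s i = 1

open Classical in
/-- `S = (U × {0^δ}) ∪ (V × T)`, where `U ⊆ {-1, 0, 1}^d \ {0^d}`, `V ⊆ {-1, 0, 1}^d` and
`T ⊆ {-1, 0, 1}^δ \ {0^δ}`: the set `S` is `(d, δ)`-Hadamard, with parts `U`, `V` and `T`. -/
structure IsHadamardWith {d δ : ℕ} (S : Finset (Fin (d + δ) → ℤ))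
    (U V : Finset (Fin d → ℤ)) (T : Finset (Fin δ → ℤ)) : Prop where
  small_U : HasSmallSteps U
  zero_notMem_U : 0 ∉ U
  small_V : HasSmallSteps V
  small_T : HasSmallSteps T
  zero_notMem_T : 0 ∉ T
  eq_union : S = U.image (fun u => Fin.append u (0 : Fin δ → ℤ)) ∪ Finset.image₂ Fin.append V T

end LatticeWalks

end

/-! The set `T` is empty, {1}, {-1} or {1, -1}. Give every white step height change 0 and every
black step height change 1, so that v marks the final height of a coloured walk. If T = {1}, the
height never decreases and O = C₁. If T contains at most -1, no step of V × T can be taken within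
the octant, so O is the part of C₁ free of v. If T = {1, -1}, replacing v by z + 1/z in C₁ chooses a
direction for each black step, hence Q(x,y,z;t) = C₁(x,y,z+1/z;t) (`walkSubst_colouredSeries`). The
reflection principle then expresses O as the nonnegative part in z of (1 - z⁻²) Q
(`walkSeries_orthant_eq_nonnegPart`); this is the second claim and does not use D-finiteness.

It remains to see that D-finiteness survives these operations. Denominators are handled by
saturation: a series counts as a combination of a finite set as soon as a nonzero polynomial
multiple of it is one. D-finiteness then means lying in a saturated submodule of finite rank stable
under the derivative (`IsDFinite.isDiffFinite`, `isDFinite_of_isDiffFinite`), or equivalently that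
the iterated derivatives are linearly dependent over polynomials.

Substitution of x + 1/x (`isDiffFinite_walkSubst`) is the chain rule, together with the fact that
the substitution does not kill a nonzero leading coefficient.

Extraction of one power of xᵢ (`isDiffFinite_slice`) is creative telescoping. A dimension count
(`not_linearIndependent_iterate_iterate`) yields a relation between the mixed derivatives of F whose
coefficients are free of xᵢ. After a maximal power of ∂/∂xᵢ is factored out, taking residues in xᵢ
leaves a nontrivial equation for the residue (`not_linearIndependent_residue`).

For the nonnegative part F⁺ (`isDiffFinite_nonnegPart`), let L be a differential operator with LF =
0. Then LF⁺ = -L(F - F⁺) has exponents of xᵢ bounded below and above, so it is a finite sum of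
slices, each D-finite. Hence F⁺ solves an equation with D-finite right-hand side, which suffices by
`IsDiffFinite.of_equation`. -/

noncomputable section

/-! ### Saturated submodules and differentially finite elements -/

namespace DiffFinite

section Saturation

variable {R M : Type*} [CommRing R] [IsDomain R] [AddCommGroup M] [Module R M]

/-- The elements which have a nonzero multiple in `N`. -/
def saturation (N : Submodule R M) : Submodule R M where
  carrier := {m | ∃ q : R, q ≠ 0 ∧ q • m ∈ N}
  add_mem' := by
    rintro a b ⟨q, hq, ha⟩ ⟨r, hr, hb⟩
    refine ⟨q * r, mul_ne_zero hq hr, ?_⟩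
    rw [smul_add, mul_comm q r, mul_smul, mul_comm r q, mul_smul]
    exact N.add_mem (N.smul_mem _ ha) (N.smul_mem _ hb)
  zero_mem' := ⟨1, one_ne_zero, by simp⟩
  smul_mem' := by
    rintro c a ⟨q, hq, ha⟩
    exact ⟨q, hq, by rw [smul_comm]; exact N.smul_mem _ ha⟩

theorem le_saturation (N : Submodule R M) : N ≤ saturation N :=
  fun m hm => ⟨1, one_ne_zero, by simpa using hm⟩

theorem mem_saturation_of_smul {N : Submodule R M} {m : M} {q : R} (hq : q ≠ 0)
    (h : q • m ∈ saturation N) : m ∈ saturation N := by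
  obtain ⟨r, hr, h⟩ := h
  exact ⟨r * q, mul_ne_zero hr hq, by rwa [mul_smul]⟩

theorem saturation_le {N N' : Submodule R M} (h : N ≤ saturation N') :
    saturation N ≤ saturation N' := by
  rintro m ⟨q, hq, hm⟩
  exact mem_saturation_of_smul hq (h hm)

theorem saturation_mono {N N' : Submodule R M} (h : N ≤ N') : saturation N ≤ saturation N' :=
  saturation_le (h.trans (le_saturation N'))

theorem saturation_span_mono {S S' : Set M} (h : S ⊆ S') :
    saturation (Submodule.span R S) ≤ saturation (Submodule.span R S') :=
  saturation_mono (Submodule.span_mono h)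

theorem mem_saturation_span {S : Set M} {e : M} (he : e ∈ S) :
    e ∈ saturation (Submodule.span R S) :=
  le_saturation _ (Submodule.subset_span he)

/-- `D` satisfies the Leibniz rule for the scalar multiplication, `δ` being the derivative of
scalars. -/
def IsLeibniz (δ : R → R) (D : M →+ M) : Prop :=
  ∀ (r : R) (m : M), D (r • m) = δ r • m + r • D m

/-- If q m is in the span, the Leibniz rule gives q D m = D (q m) - δ(q) m, and both terms on the
right are in the saturation; division by q is then free. Stability therefore needs checking on
generators only. -/
theorem map_mem_saturation {δ : R → R} {D : M →+ M} (hD : IsLeibniz δ D) {S : Set M}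
    {N : Submodule R M} (hS : ∀ e ∈ S, e ∈ saturation N) (hDS : ∀ e ∈ S, D e ∈ saturation N)
    {m : M} (hm : m ∈ saturation (Submodule.span R S)) : D m ∈ saturation N := by
  have hspan : Submodule.span R S ≤ saturation N := Submodule.span_le.2 hS
  have key : ∀ x ∈ Submodule.span R S, D x ∈ saturation N := by
    intro x hx
    induction hx using Submodule.span_induction with
    | mem x h => exact hDS x h
    | zero => simp
    | add x y _ _ hx hy => rw [map_add]; exact add_mem hx hy
    | smul a x hx' hx =>
      rw [hD]
      exact add_mem (Submodule.smul_mem _ _ (hspan hx')) (Submodule.smul_mem _ _ hx)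
  obtain ⟨q, hq, hqm⟩ := hm
  have h1 := key _ hqm
  have h2 : m ∈ saturation N := mem_saturation_of_smul hq (hspan hqm)
  rw [hD] at h1
  exact mem_saturation_of_smul hq
    ((Submodule.add_mem_iff_right _ (Submodule.smul_mem _ _ h2)).1 h1)

/-- `F` lies in a submodule of finite rank which is stable under `D`. -/
def IsDiffFinite (R : Type*) {M : Type*} [CommRing R] [IsDomain R] [AddCommGroup M] [Module R M]
    (D : M →+ M) (F : M) : Prop :=
  ∃ S : Finset M, F ∈ saturation (Submodule.span R (S : Set M)) ∧
    ∀ e ∈ S, D e ∈ saturation (Submodule.span R (S : Set M))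

theorem IsDiffFinite.iterate_mem {δ : R → R} {D : M →+ M} (hD : IsLeibniz δ D) {S : Set M} {F : M}
    (hF : F ∈ saturation (Submodule.span R S))
    (hS : ∀ e ∈ S, D e ∈ saturation (Submodule.span R S)) (m : ℕ) :
    D^[m] F ∈ saturation (Submodule.span R S) := by
  induction m with
  | zero => exact hF
  | succ m ih =>
    rw [Function.iterate_succ_apply']
    exact map_mem_saturation hD (fun e he => mem_saturation_span he) hS ih

open Classical in
/-- The submodule of differentially finite elements. -/
def diffFiniteSubmodule (R : Type*) {M : Type*} [CommRing R] [IsDomain R] [AddCommGroup M]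
    [Module R M] (D : M →+ M) : Submodule R M where
  carrier := {F | IsDiffFinite R D F}
  add_mem' := by
    rintro a b ⟨S, ha, hS⟩ ⟨S', hb, hS'⟩
    have h1 : saturation (Submodule.span R (S : Set M)) ≤
        saturation (Submodule.span R ((S ∪ S' : Finset M) : Set M)) :=
      saturation_span_mono (by simp)
    have h2 : saturation (Submodule.span R (S' : Set M)) ≤
        saturation (Submodule.span R ((S ∪ S' : Finset M) : Set M)) :=
      saturation_span_mono (by simp)
    refine ⟨S ∪ S', add_mem (h1 ha) (h2 hb), fun e he => ?_⟩
    rcases Finset.mem_union.1 he with he | he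
    · exact h1 (hS e he)
    · exact h2 (hS' e he)
  zero_mem' := ⟨∅, by simp, by simp⟩
  smul_mem' := by
    rintro c a ⟨S, ha, hS⟩
    exact ⟨S, Submodule.smul_mem _ _ ha, hS⟩

theorem mem_diffFiniteSubmodule {D : M →+ M} {F : M} :
    F ∈ diffFiniteSubmodule R D ↔ IsDiffFinite R D F := Iff.rfl

theorem IsDiffFinite.iterate {δ : R → R} {D : M →+ M} (hD : IsLeibniz δ D) {F : M}
    (h : IsDiffFinite R D F) (m : ℕ) : IsDiffFinite R D (D^[m] F) := by
  obtain ⟨S, hF, hS⟩ := h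
  exact ⟨S, iterate_mem hD hF hS m, hS⟩

open Classical in
/-- A solution of a linear differential equation whose right-hand side is differentially finite
is differentially finite. -/
theorem IsDiffFinite.of_equation {D : M →+ M} {F : M} (p : ℕ →₀ R) (hp : p ≠ 0)
    (h : IsDiffFinite R D (p.sum fun m c => c • D^[m] F)) : IsDiffFinite R D F := by
  obtain ⟨S, hy, hS⟩ := h
  have hne : p.support.Nonempty := Finsupp.support_nonempty_iff.2 hp
  set r := p.support.max' hne with hr
  have hrmem : r ∈ p.support := p.support.max'_mem hne
  have hpr : p r ≠ 0 := Finsupp.mem_support_iff.1 hrmem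
  -- The equation of order r expresses D^r F through the right-hand side and the lower derivatives.
  -- For r = 0 nothing is added to S, and F itself lies in its saturation.
  set S' := S ∪ (Finset.range r).image (fun m => D^[m] F) with hS'
  have h1 : saturation (Submodule.span R (S : Set M)) ≤
      saturation (Submodule.span R (S' : Set M)) :=
    saturation_span_mono (by simp [hS'])
  have hlow : ∀ m < r, D^[m] F ∈ saturation (Submodule.span R (S' : Set M)) := by
    intro m hm
    refine mem_saturation_span ?_
    rw [hS', Finset.mem_coe, Finset.mem_union, Finset.mem_image]
    exact Or.inr ⟨m, Finset.mem_range.2 hm, rfl⟩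
  have hr' : D^[r] F ∈ saturation (Submodule.span R (S' : Set M)) := by
    refine mem_saturation_of_smul hpr ?_
    have := Finset.add_sum_erase p.support (fun m => p m • D^[m] F) hrmem
    rw [← eq_sub_iff_add_eq] at this
    rw [this]
    refine sub_mem (h1 hy) (sum_mem fun m hm => Submodule.smul_mem _ _ (hlow m ?_))
    exact lt_of_le_of_ne (p.support.le_max' m (Finset.mem_of_mem_erase hm))
      (Finset.ne_of_mem_erase hm)
  have hle : ∀ m ≤ r, D^[m] F ∈ saturation (Submodule.span R (S' : Set M)) := by
    intro m hm
    rcases hm.lt_or_eq with hm | rfl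
    · exact hlow m hm
    · exact hr'
  refine ⟨S', hle 0 (Nat.zero_le _), fun e he => ?_⟩
  rcases Finset.mem_union.1 he with he | he
  · exact h1 (hS e he)
  · obtain ⟨m, hm, rfl⟩ := Finset.mem_image.1 he
    rw [← Function.iterate_succ_apply' (f := D)]
    exact hle _ (Finset.mem_range.1 hm)

theorem IsDiffFinite.of_not_linearIndependent {D : M →+ M} {F : M}
    (h : ¬ LinearIndependent R (fun m : ℕ => D^[m] F)) : IsDiffFinite R D F := by
  rw [linearIndependent_iff] at h
  push Not at h
  obtain ⟨p, hp, hp0⟩ := h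
  refine .of_equation p hp0 ?_
  rw [Finsupp.linearCombination_apply] at hp
  rw [hp]
  exact zero_mem (diffFiniteSubmodule R D)

end Saturation

/-! ### Finite rank and linear dependence of derivatives -/

section Rank

theorem not_linearIndependent_of_mem_span {A M ι : Type*} [CommRing A] [Nontrivial A]
    [AddCommGroup M] [Module A M] [Fintype ι] (S : Finset M) (v : ι → M)
    (hv : ∀ i, v i ∈ Submodule.span A (S : Set M)) (hS : S.card < Fintype.card ι) :
    ¬ LinearIndependent A v := by
  intro h
  have h2 : LinearIndependent A
      (fun i => (⟨v i, hv i⟩ : Submodule.span A (S : Set M))) :=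
    LinearIndependent.of_comp (Submodule.span A (S : Set M)).subtype h
  have : Module.Finite A (Submodule.span A (S : Set M)) :=
    Module.Finite.span_of_finite A S.finite_toSet
  have := h2.fintype_card_le_finrank
  have := finrank_span_finset_le_card (R := A) S
  rw [Set.finrank] at this
  omega

variable {R M : Type*} [CommRing R] [IsDomain R] [AddCommGroup M] [Module R M]

theorem exists_common_multiplier {ι : Type*} (s : Finset ι) (v : ι → M)
    {N : Submodule R M} (hv : ∀ i ∈ s, v i ∈ saturation N) :
    ∃ q : R, q ≠ 0 ∧ ∀ i ∈ s, q • v i ∈ N := by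
  classical
  induction s using Finset.induction_on with
  | empty => exact ⟨1, one_ne_zero, by simp⟩
  | insert a s _ ih =>
    obtain ⟨q, hq, h⟩ := ih fun i hi => hv i (Finset.mem_insert_of_mem hi)
    obtain ⟨r, hr, h'⟩ := hv a (Finset.mem_insert_self _ _)
    refine ⟨q * r, mul_ne_zero hq hr, fun i hi => ?_⟩
    rcases Finset.mem_insert.1 hi with rfl | hi
    · rw [mul_smul]; exact N.smul_mem _ h'
    · rw [mul_comm, mul_smul]; exact N.smul_mem _ (h i hi)

/-- By torsion-freeness, multiplication by q is an injective A-linear map, so it preserves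
independence. The multiplier is taken in R, not in A, so that denominators involving an eliminated
variable can be cleared before counting dimensions over A. -/
theorem not_linearIndependent_of_smul {A ι : Type*} [CommRing A] [Module A M]
    [Algebra A R] [IsScalarTower A R M]
    [Module.IsTorsionFree R M] {v : ι → M} {q : R} (hq : q ≠ 0)
    (h : ¬ LinearIndependent A (fun i => q • v i)) : ¬ LinearIndependent A v := by
  refine fun hv => h ?_
  have : (fun i => q • v i) = (LinearMap.lsmul R M q).restrictScalars A ∘ v := by
    ext i; simp
  rw [this]
  refine hv.map' _ (LinearMap.ker_eq_bot.2 fun a b hab => ?_)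
  exact smul_right_injective M hq (by simpa using hab)

/-- One more derivative than there are generators: after multiplication by a common denominator they
all lie in the span of `S`, which is too small. -/
theorem IsDiffFinite.not_linearIndependent [Module.IsTorsionFree R M] {δ : R → R} {D : M →+ M}
    (hD : IsLeibniz δ D) {F : M} (h : IsDiffFinite R D F) :
    ¬ LinearIndependent R (fun m : ℕ => D^[m] F) := by
  obtain ⟨S, hF, hS⟩ := h
  intro hli
  have hli' : LinearIndependent R (fun m : Fin (S.card + 1) => D^[(m : ℕ)] F) :=
    hli.comp _ Fin.val_injective
  obtain ⟨q, hq, hqv⟩ := exists_common_multiplier (N := Submodule.span R (S : Set M)) Finset.univ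
    (fun m : Fin (S.card + 1) => D^[(m : ℕ)] F)
    (fun i _ => iterate_mem hD hF hS i)
  exact not_linearIndependent_of_smul (A := R) hq
    (not_linearIndependent_of_mem_span S _ (fun i => hqv i (Finset.mem_univ _)) (by simp)) hli'

open Classical in
/-- Finiteness with respect to two commuting derivations gives a submodule of finite rank which is
stable under both. -/
theorem IsDiffFinite.joint [Module.IsTorsionFree R M] {δ₁ δ₂ : R → R} {D₁ D₂ : M →+ M}
    (hD₁ : IsLeibniz δ₁ D₁) (hD₂ : IsLeibniz δ₂ D₂) (hcomm : ∀ x, D₁ (D₂ x) = D₂ (D₁ x)) {F : M}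
    (h₁ : IsDiffFinite R D₁ F) (h₂ : IsDiffFinite R D₂ F) :
    ∃ S : Finset M, F ∈ S ∧ (∀ e ∈ S, D₁ e ∈ saturation (Submodule.span R (S : Set M))) ∧
      ∀ e ∈ S, D₂ e ∈ saturation (Submodule.span R (S : Set M)) := by
  have low : ∀ {D : M →+ M} {δ : R → R}, IsLeibniz δ D → IsDiffFinite R D F →
      ∃ r, 0 < r ∧ D^[r] F ∈ saturation (Submodule.span R
        ((fun m => D^[m] F) '' {m | m < r})) := by
    intro D δ hD hF
    have h := hF.not_linearIndependent hD
    rw [linearIndependent_iff] at h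
    push Not at h
    obtain ⟨p, hp, hp0⟩ := h
    rw [Finsupp.linearCombination_apply] at hp
    have hne : p.support.Nonempty := Finsupp.support_nonempty_iff.2 hp0
    set r := p.support.max' hne with hr
    have hrmem : r ∈ p.support := p.support.max'_mem hne
    have hrm : D^[r] F ∈ saturation (Submodule.span R ((fun m => D^[m] F) '' {m | m < r})) := by
      refine mem_saturation_of_smul (Finsupp.mem_support_iff.1 hrmem) ?_
      have := Finset.add_sum_erase p.support (fun m => p m • D^[m] F) hrmem
      rw [← eq_sub_iff_add_eq] at this
      rw [this]
      refine sub_mem (by rw [Finsupp.sum] at hp; rw [hp]; exact zero_mem _)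
        (sum_mem fun m hm => Submodule.smul_mem _ _ (mem_saturation_span ⟨m, ?_, rfl⟩))
      exact lt_of_le_of_ne (p.support.le_max' m (Finset.mem_of_mem_erase hm))
        (Finset.ne_of_mem_erase hm)
    -- The relation is differentiated once to make the order positive: F itself must be among the
    -- mixed derivatives D₁^a D₂^b F with a < r₁ and b < r₂ that are kept in the end.
    refine ⟨r + 1, Nat.succ_pos _, ?_⟩
    rw [Function.iterate_succ_apply']
    refine map_mem_saturation hD (fun e he => ?_) (fun e he => ?_) hrm
    · obtain ⟨m, hm, rfl⟩ := he
      exact mem_saturation_span ⟨m, Nat.lt_succ_of_lt hm, rfl⟩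
    · obtain ⟨m, hm, rfl⟩ := he
      exact mem_saturation_span
        ⟨m + 1, Nat.succ_lt_succ hm, Function.iterate_succ_apply' _ _ _⟩
  -- Applying E repeatedly to a combination of the D^m F with m < r never increases the order in D,
  -- and increases that in E by at most one each time. This reduces a mixed derivative at the border
  -- of the r₁ × r₂ box to those inside it.
  have iter : ∀ {D E : M →+ M} {ε : R → R}, IsLeibniz ε E → (∀ x, D (E x) = E (D x)) →
      ∀ (r : ℕ) (x : M),
      x ∈ saturation (Submodule.span R ((fun m => D^[m] F) '' {m | m < r})) → ∀ b : ℕ,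
      E^[b] x ∈ saturation (Submodule.span R
        ((fun j : ℕ × ℕ => D^[j.1] (E^[j.2] F)) '' {j | j.1 < r ∧ j.2 ≤ b})) := by
    intro D E ε hE hDE r x hx b
    induction b with
    | zero =>
      refine saturation_span_mono ?_ hx
      rintro _ ⟨m, hm, rfl⟩
      exact ⟨(m, 0), ⟨hm, le_rfl⟩, rfl⟩
    | succ b ih =>
      rw [Function.iterate_succ_apply']
      refine map_mem_saturation hE (fun e he => ?_) (fun e he => ?_) ih
      · obtain ⟨j, hj, rfl⟩ := he
        exact mem_saturation_span ⟨j, ⟨hj.1, hj.2.trans (Nat.le_succ _)⟩, rfl⟩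
      · obtain ⟨j, hj, rfl⟩ := he
        refine mem_saturation_span ⟨(j.1, j.2 + 1), ⟨hj.1, Nat.succ_le_succ hj.2⟩, ?_⟩
        have hc : Function.Commute E D := fun x => (hDE x).symm
        simp only [Function.iterate_succ_apply' E]
        exact ((hc.iterate_right j.1) _).symm
  obtain ⟨r₁, hr₁, hF₁⟩ := low hD₁ h₁
  obtain ⟨r₂, hr₂, hF₂⟩ := low hD₂ h₂
  have hc : Function.Commute D₁ D₂ := hcomm
  set S := (Finset.range r₁ ×ˢ Finset.range r₂).image
    (fun j : ℕ × ℕ => D₁^[j.1] (D₂^[j.2] F)) with hS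
  have hmem : ∀ a < r₁, ∀ b < r₂, D₁^[a] (D₂^[b] F) ∈ S := by
    intro a ha b hb
    exact Finset.mem_image.2 ⟨(a, b), by simp [ha, hb], rfl⟩
  refine ⟨S, hmem 0 hr₁ 0 hr₂, fun e he => ?_, fun e he => ?_⟩
  · obtain ⟨⟨a, b⟩, hj, rfl⟩ := Finset.mem_image.1 he
    simp only [Finset.mem_product, Finset.mem_range] at hj
    simp only
    rw [← Function.iterate_succ_apply' (f := D₁)]
    rcases (Nat.succ_le_of_lt hj.1).lt_or_eq with ha | ha
    · exact mem_saturation_span (hmem _ ha _ hj.2)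
    · rw [ha, (hc.iterate_iterate r₁ b) F]
      refine saturation_span_mono ?_ (iter hD₂ hcomm r₁ _ hF₁ b)
      rintro _ ⟨j, hj', rfl⟩
      exact hmem _ hj'.1 _ (hj'.2.trans_lt hj.2)
  · obtain ⟨⟨a, b⟩, hj, rfl⟩ := Finset.mem_image.1 he
    simp only [Finset.mem_product, Finset.mem_range] at hj
    simp only
    rw [(hc.symm.iterate_right a) _, ← Function.iterate_succ_apply' (f := D₂)]
    rcases (Nat.succ_le_of_lt hj.2).lt_or_eq with hb | hb
    · exact mem_saturation_span (hmem _ hj.1 _ hb)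
    · rw [hb]
      refine saturation_span_mono ?_ (iter hD₁ (fun x => (hcomm x).symm) r₂ _ hF₂ a)
      rintro _ ⟨j, hj', rfl⟩
      simp only
      rw [← (hc.iterate_iterate j.2 j.1) F]
      exact hmem _ (hj'.2.trans_lt hj.1) _ hj'.1

end Rank

/-! ### Elimination of a variable -/

section Elimination

variable {A R M : Type*} [CommRing A] [CommRing R] [Algebra A R]
  [AddCommGroup M] [Module R M] [Module A M]

/-- The polynomials in `s` with coefficients in `A` of degree at most `d`. -/
def degreeFiltration (A : Type*) {R : Type*} [CommRing A] [CommRing R] [Algebra A R] (s : R)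
    (d : ℕ) : Submodule A R :=
  Submodule.span A ((fun i => s ^ i) '' {i | i ≤ d})

theorem degreeFiltration_mono (s : R) {c d : ℕ} (h : c ≤ d) :
    degreeFiltration A s c ≤ degreeFiltration A s d :=
  Submodule.span_mono (Set.image_mono fun _ hi => le_trans hi h)

theorem pow_mem_degreeFiltration (s : R) {i d : ℕ} (h : i ≤ d) :
    s ^ i ∈ degreeFiltration A s d :=
  Submodule.subset_span ⟨i, h, rfl⟩

theorem algebraMap_mem_degreeFiltration (s : R) (a : A) (d : ℕ) :
    algebraMap A R a ∈ degreeFiltration A s d := by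
  rw [Algebra.algebraMap_eq_smul_one, ← pow_zero s]
  exact Submodule.smul_mem _ _ (pow_mem_degreeFiltration s (Nat.zero_le d))

theorem mul_mem_degreeFiltration {s : R} {c d : ℕ} {f g : R} (hf : f ∈ degreeFiltration A s c)
    (hg : g ∈ degreeFiltration A s d) : f * g ∈ degreeFiltration A s (c + d) := by
  have h := Submodule.mul_mem_mul hf hg
  rw [degreeFiltration, degreeFiltration, Submodule.span_mul_span] at h
  refine Submodule.span_mono ?_ h
  rintro _ ⟨_, ⟨i, hi, rfl⟩, _, ⟨j, hj, rfl⟩, rfl⟩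
  exact ⟨i + j, (Nat.add_le_add hi hj : i + j ≤ c + d), pow_add _ _ _⟩

/-- The combinations of elements of `S` with coefficients of degree at most `d` in `s`. -/
def moduleFiltration (A : Type*) {R M : Type*} [CommRing A] [CommRing R] [Algebra A R]
    [AddCommGroup M] [Module R M] [Module A M] (s : R) (S : Set M) (d : ℕ) : Submodule A M :=
  Submodule.span A {x | ∃ f ∈ degreeFiltration A s d, ∃ e ∈ S, x = f • e}

theorem moduleFiltration_mono (s : R) (S : Set M) {c d : ℕ} (h : c ≤ d) :
    moduleFiltration A s S c ≤ moduleFiltration A s S d :=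
  Submodule.span_mono fun _ ⟨f, hf, e, he, hx⟩ => ⟨f, degreeFiltration_mono s h hf, e, he, hx⟩

variable [IsScalarTower A R M]

theorem smul_mem_moduleFiltration {s : R} {S : Set M} {c d : ℕ} {f : R} {x : M}
    (hf : f ∈ degreeFiltration A s c) (hx : x ∈ moduleFiltration A s S d) :
    f • x ∈ moduleFiltration A s S (c + d) := by
  induction hx using Submodule.span_induction with
  | mem x h =>
    obtain ⟨g, hg, e, he, rfl⟩ := h
    exact Submodule.subset_span ⟨f * g, mul_mem_degreeFiltration hf hg, e, he, smul_smul _ _ _⟩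
  | zero => rw [smul_zero]; exact zero_mem _
  | add x y _ _ hx hy => rw [smul_add]; exact add_mem hx hy
  | smul a x _ hx => rw [smul_algebra_smul_comm]; exact Submodule.smul_mem _ _ hx

open Classical in
theorem moduleFiltration_le_span (s : R) (S : Finset M) (d : ℕ) :
    moduleFiltration A s (S : Set M) d ≤ Submodule.span A
      (((Finset.range (d + 1) ×ˢ S).image fun j => s ^ j.1 • j.2 : Finset M) : Set M) := by
  refine Submodule.span_le.2 ?_
  rintro _ ⟨f, hf, e, he, rfl⟩
  simp only [SetLike.mem_coe]
  induction hf using Submodule.span_induction with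
  | mem x h =>
    obtain ⟨i, hi, rfl⟩ := h
    refine Submodule.subset_span (Finset.mem_image.2 ⟨(i, e), ?_, rfl⟩)
    exact Finset.mem_product.2 ⟨Finset.mem_range.2 (Nat.lt_succ_of_le hi), he⟩
  | zero => rw [zero_smul]; exact zero_mem _
  | add x y _ _ hx hy => rw [add_smul]; exact add_mem hx hy
  | smul a x _ hx => rw [smul_assoc]; exact Submodule.smul_mem _ _ hx

theorem exists_mem_moduleFiltration {s : R} (hs : ∀ f : R, ∃ d, f ∈ degreeFiltration A s d)
    (S : Set M) {x : M} (hx : x ∈ Submodule.span R S) : ∃ d, x ∈ moduleFiltration A s S d := by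
  induction hx using Submodule.span_induction with
  | mem x h =>
    refine ⟨0, Submodule.subset_span ⟨1, ?_, x, h, (one_smul _ _).symm⟩⟩
    simpa using algebraMap_mem_degreeFiltration s (1 : A) 0
  | zero => exact ⟨0, zero_mem _⟩
  | add x y _ _ hx hy =>
    obtain ⟨c, hc⟩ := hx
    obtain ⟨d, hd⟩ := hy
    exact ⟨max c d, add_mem (moduleFiltration_mono s S (le_max_left _ _) hc)
      (moduleFiltration_mono s S (le_max_right _ _) hd)⟩
  | smul a x _ hx =>
    obtain ⟨c, hc⟩ := hx
    obtain ⟨d, hd⟩ := hs a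
    exact ⟨d + c, smul_mem_moduleFiltration hd hc⟩

/-- Differentiating a coefficient does not raise its degree in s, and differentiating a generator
costs the denominator q and degree c. So q D raises the filtration by c only, whatever the starting
degree. -/
theorem derivation_mem_moduleFiltration {s : R} {δ : R → R} {D : M →+ M} (hD : IsLeibniz δ D)
    (hδ : ∀ d, ∀ f ∈ degreeFiltration A s d, δ f ∈ degreeFiltration A s d) {S : Set M} {q : R}
    {c : ℕ} (hq : q ∈ degreeFiltration A s c)
    (hS : ∀ e ∈ S, q • D e ∈ moduleFiltration A s S c) {d : ℕ} {x : M}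
    (hx : x ∈ moduleFiltration A s S d) : q • D x ∈ moduleFiltration A s S (c + d) := by
  induction hx using Submodule.span_induction with
  | mem x h =>
    obtain ⟨f, hf, e, he, rfl⟩ := h
    rw [hD, smul_add, smul_smul, smul_comm q f]
    refine add_mem (Submodule.subset_span
      ⟨_, mul_mem_degreeFiltration hq (hδ d f hf), e, he, rfl⟩) ?_
    rw [add_comm]
    exact smul_mem_moduleFiltration hf (hS e he)
  | zero => rw [map_zero, smul_zero]; exact zero_mem _
  | add x y _ _ hx hy => rw [map_add, smul_add]; exact add_mem hx hy
  | smul a x hx' hx =>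
    rw [← algebraMap_smul R a x, hD, smul_add]
    refine add_mem ?_ ?_
    · refine smul_mem_moduleFiltration hq ?_
      rw [← zero_add d]
      exact smul_mem_moduleFiltration (hδ 0 _ (algebraMap_mem_degreeFiltration s a 0)) hx'
    · rw [smul_comm, algebraMap_smul]
      exact Submodule.smul_mem _ _ hx

/-- From q D(qⁿ x) = n δ(q) qⁿ x + qⁿ⁺¹ D x: each further derivative costs one factor q and degree
c. This linear growth is what makes the dimension count succeed. -/
theorem pow_smul_derivation_mem {s : R} {δ : R → R} {D : M →+ M} (hD : IsLeibniz δ D)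
    (hδ : ∀ d, ∀ f ∈ degreeFiltration A s d, δ f ∈ degreeFiltration A s d)
    {S : Set M} {q : R} {c : ℕ}
    (hq : q ∈ degreeFiltration A s c) (hq' : ∀ n : ℕ, δ (q ^ (n + 1)) = ((n : R) + 1) * q ^ n * δ q)
    (hS : ∀ e ∈ S, q • D e ∈ moduleFiltration A s S c) {n : ℕ} {x : M} (hq0 : δ 1 = 0)
    (hx : q ^ n • x ∈ moduleFiltration A s S (c * n)) :
    q ^ (n + 1) • D x ∈ moduleFiltration A s S (c * (n + 1)) := by
  have h1 := derivation_mem_moduleFiltration hD hδ hq hS hx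
  have h2 : q • D (q ^ n • x) = ((n : ℕ) : A) • (δ q • (q ^ n • x)) + q ^ (n + 1) • D x := by
    rw [hD, smul_add, smul_smul, smul_smul, pow_succ' q n]
    congr 1
    rcases n with _ | n
    · simp [hq0]
    · rw [hq', smul_smul, ← algebraMap_smul R ((n + 1 : ℕ) : A), smul_smul]
      congr 1
      push_cast
      ring
  rw [h2] at h1
  rw [mul_add, mul_one, add_comm]
  refine (Submodule.add_mem_iff_right _ (Submodule.smul_mem _ _ ?_)).1 h1
  exact smul_mem_moduleFiltration (hδ c q hq) hx

open Classical in
/-- Let `S` span a submodule of finite rank which is stable under two derivations `D₁`, `D₂`. The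
elements `D₁ ^ j (D₂ ^ l F)` satisfy a linear relation whose coefficients do not involve `s`. -/
theorem not_linearIndependent_iterate_iterate {k : Type*} [CommRing k] [Algebra k R] [IsDomain R]
    [Nontrivial A]
    [Module.IsTorsionFree R M] {s : R}
    (hs : ∀ f : R, ∃ d, f ∈ degreeFiltration A s d) {δ₁ δ₂ : Derivation k R R} {D₁ D₂ : M →+ M}
    (hD₁ : IsLeibniz δ₁ D₁) (hD₂ : IsLeibniz δ₂ D₂)
    (hδ₁ : ∀ d, ∀ f ∈ degreeFiltration A s d, δ₁ f ∈ degreeFiltration A s d)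
    (hδ₂ : ∀ d, ∀ f ∈ degreeFiltration A s d, δ₂ f ∈ degreeFiltration A s d)
    {S : Finset M} {F : M} (hF : F ∈ S)
    (hS₁ : ∀ e ∈ S, D₁ e ∈ saturation (Submodule.span R (S : Set M)))
    (hS₂ : ∀ e ∈ S, D₂ e ∈ saturation (Submodule.span R (S : Set M))) :
    ¬ LinearIndependent A (fun j : ℕ × ℕ => D₁^[j.1] (D₂^[j.2] F)) := by
  obtain ⟨q₁, hq₁, h₁⟩ := exists_common_multiplier S D₁ hS₁
  obtain ⟨q₂, hq₂, h₂⟩ := exists_common_multiplier S D₂ hS₂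
  have hq : q₁ * q₂ ≠ 0 := mul_ne_zero hq₁ hq₂
  set q := q₁ * q₂ with hqdef
  replace h₁ : ∀ e ∈ S, q • D₁ e ∈ Submodule.span R (S : Set M) := fun e he => by
    rw [hqdef, mul_comm, mul_smul]; exact Submodule.smul_mem _ _ (h₁ e he)
  replace h₂ : ∀ e ∈ S, q • D₂ e ∈ Submodule.span R (S : Set M) := fun e he => by
    rw [hqdef, mul_smul]; exact Submodule.smul_mem _ _ (h₂ e he)
  obtain ⟨c, hqc, hc₁, hc₂⟩ : ∃ c, q ∈ degreeFiltration A s c ∧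
      (∀ e ∈ S, q • D₁ e ∈ moduleFiltration A s (S : Set M) c) ∧
      (∀ e ∈ S, q • D₂ e ∈ moduleFiltration A s (S : Set M) c) := by
    obtain ⟨c₀, hc₀⟩ := hs q
    have bound : ∀ D : M →+ M, (∀ e ∈ S, q • D e ∈ Submodule.span R (S : Set M)) →
        ∃ c, ∀ e ∈ S, q • D e ∈ moduleFiltration A s (S : Set M) c := by
      intro D hD
      choose! d hd using fun e he => exists_mem_moduleFiltration (A := A) hs (S : Set M) (hD e he)
      exact ⟨S.sup d, fun e he => moduleFiltration_mono s _ (Finset.le_sup he) (hd e he)⟩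
    obtain ⟨c₁, hc₁⟩ := bound D₁ h₁
    obtain ⟨c₂, hc₂⟩ := bound D₂ h₂
    refine ⟨max c₀ (max c₁ c₂), degreeFiltration_mono s (le_max_left _ _) hc₀,
      fun e he => moduleFiltration_mono s _ ?_ (hc₁ e he),
      fun e he => moduleFiltration_mono s _ ?_ (hc₂ e he)⟩
    · exact (le_max_left _ _).trans (le_max_right _ _)
    · exact (le_max_right _ _).trans (le_max_right _ _)
  have hpow : ∀ δ : Derivation k R R, ∀ n : ℕ, δ (q ^ (n + 1)) = (n + 1) * q ^ n * δ q := by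
    intro δ n
    rw [Derivation.leibniz_pow]
    simp [mul_assoc]
  have hF2 : ∀ l : ℕ, q ^ l • D₂^[l] F ∈ moduleFiltration A s (S : Set M) (c * l) := by
    intro l
    induction l with
    | zero =>
      refine Submodule.subset_span ⟨1, ?_, F, hF, by simp⟩
      simpa using algebraMap_mem_degreeFiltration s (1 : A) (c * 0)
    | succ l ih =>
      rw [Function.iterate_succ_apply']
      exact pow_smul_derivation_mem hD₂ hδ₂ hqc (hpow δ₂) hc₂ δ₂.map_one_eq_zero ih
  have hF12 : ∀ j l : ℕ,
      q ^ (l + j) • D₁^[j] (D₂^[l] F) ∈ moduleFiltration A s (S : Set M) (c * (l + j)) := by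
    intro j l
    induction j with
    | zero => exact hF2 l
    | succ j ih =>
      rw [Function.iterate_succ_apply', ← add_assoc]
      exact pow_smul_derivation_mem hD₁ hδ₁ hqc (hpow δ₁) hc₁ δ₁.map_one_eq_zero ih
  have hqpow : ∀ n, q ^ n ∈ degreeFiltration A s (c * n) := by
    intro n
    induction n with
    | zero => simpa using algebraMap_mem_degreeFiltration s (1 : A) 0
    | succ n ih => rw [pow_succ, mul_add, mul_one]; exact mul_mem_degreeFiltration ih hqc
  -- There are N² mixed derivatives of orders below N in each derivation. Multiplied by q^(2N), they
  -- lie in the A-span of the s^i e with i ≤ 2cN and e in S, which are at most (2cN + 1)|S| ≤ (2c +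
  -- 1)|S| N < N² elements.
  set N := (2 * c + 1) * S.card + 1 with hN
  intro hli
  have hli' : LinearIndependent A
      (fun j : Fin N × Fin N => D₁^[(j.1 : ℕ)] (D₂^[(j.2 : ℕ)] F)) :=
    hli.comp (fun j : Fin N × Fin N => ((j.1 : ℕ), (j.2 : ℕ))) (by
      rintro ⟨a, b⟩ ⟨a', b'⟩ h
      simpa [Fin.ext_iff] using h)
  refine not_linearIndependent_of_smul (A := A) (pow_ne_zero (2 * N) hq) ?_ hli'
  refine not_linearIndependent_of_mem_span
    ((Finset.range (c * (2 * N) + 1) ×ˢ S).image fun j => s ^ j.1 • j.2) _ (fun j => ?_) ?_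
  · refine moduleFiltration_le_span s S _ ?_
    -- The same power q^(2N) serves for all derivatives; the k unused factors of q contribute degree
    -- at most ck.
    have hle : (j.2 : ℕ) + j.1 ≤ 2 * N := by omega
    obtain ⟨k, hk⟩ := Nat.exists_eq_add_of_le hle
    rw [hk, add_comm _ k, pow_add, mul_smul, mul_add]
    exact smul_mem_moduleFiltration (hqpow k) (hF12 _ _)
  · refine Finset.card_image_le.trans_lt ?_
    rw [Finset.card_product, Finset.card_range, Fintype.card_prod, Fintype.card_fin]
    have h1 : 1 ≤ N := by omega
    calc (c * (2 * N) + 1) * S.card ≤ ((2 * c + 1) * S.card) * N := by nlinarith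
      _ < N * N := by nlinarith

/-- If the operator `ρ` vanishes on derivatives with respect to `D₁` and commutes with `D₂`, then
it preserves differential finiteness with respect to `D₂`. -/
theorem not_linearIndependent_residue {D₁ ρ : M →ₗ[A] M} {D₂ : M →+ M} (hρ₁ : ∀ x, ρ (D₁ x) = 0)
    (hρ₂ : ∀ x, ρ (D₂ x) = D₂ (ρ x)) (hρ : ∀ j x, D₁^[j] x = 0 → ρ x = 0) {F : M}
    (h : ¬ LinearIndependent A (fun j : ℕ × ℕ => D₁^[j.1] (D₂^[j.2] F))) :
    ¬ LinearIndependent A (fun l : ℕ => D₂^[l] (ρ F)) := by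
  classical
  rw [linearIndependent_iff] at h
  push Not at h
  obtain ⟨p, hp, hp0⟩ := h
  have hne : (p.support.image Prod.fst).Nonempty :=
    (Finsupp.support_nonempty_iff.2 hp0).image _
  -- The least order in D₁ occurring in the relation: the operator is D₁^a composed with one that
  -- has a term free of D₁.
  set a := (p.support.image Prod.fst).min' hne with ha
  obtain ⟨b, hab⟩ : ∃ b, (a, b) ∈ p.support := by
    obtain ⟨⟨a', b⟩, hab, hab'⟩ := Finset.mem_image.1 ((p.support.image Prod.fst).min'_mem hne)
    exact ⟨b, by rwa [ha, ← hab']⟩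
  have hmin : ∀ j ∈ p.support, a ≤ j.1 := fun j hj =>
    Finset.min'_le _ _ (Finset.mem_image_of_mem _ hj)
  have hiter : ∀ j, ∀ x : M, (D₁^[j]) x = (D₁ ^ j) x := fun j x => by
    rw [Module.End.pow_apply]
  -- The relation with D₁^a factored out. The factorization is legitimate since D₁ is A-linear, the
  -- coefficients being on the left; `hρ` then gives ρ K = 0.
  set K : M := p.sum fun j c => c • D₁^[j.1 - a] (D₂^[j.2] F) with hK
  have hKa : D₁^[a] K = 0 := by
    rw [hiter, hK, Finsupp.sum, map_sum, ← hp, Finsupp.linearCombination_apply, Finsupp.sum]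
    refine Finset.sum_congr rfl fun j hj => ?_
    rw [map_smul, ← hiter, ← Function.iterate_add_apply, Nat.add_sub_cancel' (hmin j hj)]
  have hρK := hρ _ _ hKa
  have hρD : ∀ l, ∀ x, ρ (D₂^[l] x) = D₂^[l] (ρ x) := by
    intro l x
    induction l with
    | zero => rfl
    | succ l ih => rw [Function.iterate_succ_apply', Function.iterate_succ_apply', hρ₂, ih]
  intro hli
  rw [linearIndependent_iff] at hli
  have hinj : Set.InjOn (fun l => (a, l)) ((fun l => (a, l)) ⁻¹' (p.support : Set (ℕ × ℕ))) :=
    fun x _ y _ hxy => (Prod.ext_iff.1 hxy).2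
  set p' := p.comapDomain (fun l => (a, l)) hinj with hp'
  have hp'a : ∀ l, p' l = p (a, l) := fun _ => rfl
  -- In ρ K = 0 every term with a positive power of D₁ vanishes. What remains is a relation between
  -- the D₂^l (ρ F) with coefficients p (a, l), and that at l = b is nonzero.
  have := hli p' (by
    rw [Finsupp.linearCombination_apply, Finsupp.sum]
    rw [hK, Finsupp.sum, map_sum] at hρK
    rw [← hρK]
    refine Finset.sum_bij_ne_zero (fun l _ _ => (a, l)) ?_ ?_ ?_ ?_
    · intro l hl _
      rwa [Finsupp.mem_support_iff, ← hp'a, ← Finsupp.mem_support_iff]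
    · intro l _ _ l' _ _ hll
      simpa using hll
    · intro j hj hjne
      rcases (hmin j hj).lt_or_eq with hlt | heq
      · refine absurd ?_ hjne
        obtain ⟨k, hk⟩ : ∃ k, j.1 - a = k + 1 := ⟨j.1 - a - 1, by omega⟩
        rw [hk, Function.iterate_succ_apply', map_smul, hρ₁, smul_zero]
      · refine ⟨j.2, ?_, ?_, ?_⟩
        · rw [Finsupp.mem_support_iff, hp'a, heq]
          exact Finsupp.mem_support_iff.1 hj
        · rw [hp'a, heq, ← hρD]
          simpa [heq] using hjne
        · rw [heq]
    · intro l _ _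
      rw [Nat.sub_self, Function.iterate_zero_apply, map_smul, hρD, hp'a])
  have h2 := DFunLike.congr_fun this b
  rw [hp'a] at h2
  exact Finsupp.mem_support_iff.1 hab h2

end Elimination

end DiffFinite

namespace LatticeWalks

open DiffFinite

/-! ### Coefficients, derivatives and polynomial multiples of walk series -/

section Basics

variable {d : ℕ}

/-- The coefficient of `x ^ p * t ^ n`. -/
def walkCoeff (F : WalkSeries d) (n : ℕ) (p : Fin d → ℤ) : ℚ := (PowerSeries.coeff n F).coeff p

theorem laurentPoly_ext {f g : LaurentPoly d} (h : ∀ p, f.coeff p = g.coeff p) : f = g :=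
  AddMonoidAlgebra.coeff_inj.1 (Finsupp.ext h)

theorem walkSeries_ext {F G : WalkSeries d} (h : ∀ n p, walkCoeff F n p = walkCoeff G n p) :
    F = G :=
  PowerSeries.ext fun n => laurentPoly_ext (h n)

theorem walkCoeff_add (F G : WalkSeries d) (n : ℕ) (p : Fin d → ℤ) :
    walkCoeff (F + G) n p = walkCoeff F n p + walkCoeff G n p := by
  simp [walkCoeff]

theorem walkCoeff_sub (F G : WalkSeries d) (n : ℕ) (p : Fin d → ℤ) :
    walkCoeff (F - G) n p = walkCoeff F n p - walkCoeff G n p := by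
  have := walkCoeff_add (F - G) G n p
  rw [sub_add_cancel] at this
  rw [this, add_sub_cancel_right]

theorem walkCoeff_zero (n : ℕ) (p : Fin d → ℤ) : walkCoeff (0 : WalkSeries d) n p = 0 := by
  simp [walkCoeff]

theorem coeff_monom_mul (q : Fin d → ℤ) (f : LaurentPoly d) (p : Fin d → ℤ) :
    (monom q * f).coeff p = f.coeff (p - q) := by
  rw [monom, AddMonoidAlgebra.coeff_single_mul_apply, one_mul, neg_add_eq_sub]

theorem monom_mul_monom (p q : Fin d → ℤ) : monom p * monom q = monom (p + q) := by
  rw [monom, monom, monom, AddMonoidAlgebra.single_mul_single, one_mul]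

theorem monom_zero : monom (0 : Fin d → ℤ) = 1 := AddMonoidAlgebra.one_def.symm

theorem walkCoeff_C_mul (f : LaurentPoly d) (F : WalkSeries d) (n : ℕ) (p : Fin d → ℤ) :
    walkCoeff (PowerSeries.C f * F) n p = (f * PowerSeries.coeff n F).coeff p := by
  rw [walkCoeff, PowerSeries.coeff_C_mul]

theorem walkCoeff_monom_mul (q : Fin d → ℤ) (F : WalkSeries d) (n : ℕ) (p : Fin d → ℤ) :
    walkCoeff (PowerSeries.C (monom q) * F) n p = walkCoeff F n (p - q) := by
  rw [walkCoeff_C_mul, coeff_monom_mul, walkCoeff]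

theorem smul_eq_algebraMap_mul (f : PolyRing d) (F : WalkSeries d) :
    f • F = algebraMap (PolyRing d) (WalkSeries d) f * F := Algebra.smul_def f F

theorem algebraMap_polyRing_apply (f : PolyRing d) :
    algebraMap (PolyRing d) (WalkSeries d) f =
      MvPolynomial.aeval (R := ℚ) (variableSeries (d := d)) f := rfl

theorem X_smul (u : Option (Fin d)) (F : WalkSeries d) :
    (MvPolynomial.X u : PolyRing d) • F = variableSeries u * F := by
  rw [smul_eq_algebraMap_mul, algebraMap_polyRing_apply, MvPolynomial.aeval_X]

theorem C_smul (c : ℚ) (F : WalkSeries d) :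
    (MvPolynomial.C c : PolyRing d) • F = c • F := by
  rw [smul_eq_algebraMap_mul, algebraMap_polyRing_apply, MvPolynomial.aeval_C, Algebra.smul_def]

theorem walkCoeff_smul (c : ℚ) (F : WalkSeries d) (n : ℕ) (p : Fin d → ℤ) :
    walkCoeff (c • F) n p = c * walkCoeff F n p := by
  simp [walkCoeff]

theorem walkCoeff_X_none_smul_zero (F : WalkSeries d) (p : Fin d → ℤ) :
    walkCoeff ((MvPolynomial.X none : PolyRing d) • F) 0 p = 0 := by
  rw [X_smul, variableSeries, walkCoeff, PowerSeries.coeff_zero_X_mul]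
  rfl

theorem walkCoeff_X_none_smul_succ (F : WalkSeries d) (n : ℕ) (p : Fin d → ℤ) :
    walkCoeff ((MvPolynomial.X none : PolyRing d) • F) (n + 1) p = walkCoeff F n p := by
  rw [X_smul, variableSeries, walkCoeff, PowerSeries.coeff_succ_X_mul, walkCoeff]

theorem walkCoeff_X_some_smul (i : Fin d) (F : WalkSeries d) (n : ℕ) (p : Fin d → ℤ) :
    walkCoeff ((MvPolynomial.X (some i) : PolyRing d) • F) n p =
      walkCoeff F n (p - Pi.single i 1) := by
  rw [X_smul, variableSeries, walkCoeff_monom_mul]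

/-- Induction on the number of factors of a polynomial acting on a series. -/
theorem polyRing_induction {motive : PolyRing d → Prop} (f : PolyRing d)
    (const : ∀ c : ℚ, motive (MvPolynomial.C c)) (add : ∀ f g, motive f → motive g → motive (f + g))
    (mul : ∀ f u, motive f → motive (MvPolynomial.X u * f)) : motive f :=
  MvPolynomial.induction_on f const add fun f u h => by rw [mul_comm]; exact mul f u h

theorem prod_variableSeries (m : Option (Fin d) →₀ ℕ) :
    (m.prod fun u k => variableSeries (d := d) u ^ k) =
      PowerSeries.C (monom fun i => (m (some i) : ℤ)) * PowerSeries.X ^ m none := by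
  rw [Finsupp.prod_fintype _ _ (fun _ => pow_zero _), Fintype.prod_option, mul_comm]
  congr 1
  simp only [variableSeries]
  simp_rw [← map_pow, ← map_prod]
  congr 1
  have hpow : ∀ (i : Fin d) (k : ℕ), (monom (Pi.single i 1) : LaurentPoly d) ^ k =
      monom (Pi.single i (k : ℤ)) := by
    intro i k
    induction k with
    | zero => rw [pow_zero, Nat.cast_zero, Pi.single_zero, monom_zero]
    | succ k ih => rw [pow_succ, ih, monom_mul_monom, ← Pi.single_add, Nat.cast_succ]
  simp_rw [hpow]
  have hsum : ∀ (s : Finset (Fin d)) (v : Fin d → Fin d → ℤ),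
      ∏ i ∈ s, (monom (v i) : LaurentPoly d) = monom (∑ i ∈ s, v i) := by
    intro s v
    induction s using Finset.cons_induction with
    | empty => simp [monom_zero]
    | cons a s ha ih => rw [Finset.prod_cons, Finset.sum_cons, ih, monom_mul_monom]
  rw [hsum, Finset.univ_sum_single]

theorem walkCoeff_algebraMap (f : PolyRing d) (m : Option (Fin d) →₀ ℕ) :
    walkCoeff (algebraMap (PolyRing d) (WalkSeries d) f) (m none) (fun i => (m (some i) : ℤ)) =
      MvPolynomial.coeff m f := by
  induction f using MvPolynomial.induction_on' with
  | monomial u a =>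
    rw [algebraMap_polyRing_apply, MvPolynomial.aeval_monomial, prod_variableSeries,
      ← Algebra.smul_def, walkCoeff_smul, walkCoeff, PowerSeries.coeff_C_mul,
      PowerSeries.coeff_X_pow, MvPolynomial.coeff_monomial]
    by_cases h : u = m
    · subst h
      simp [monom]
    · rw [if_neg h]
      by_cases h0 : m none = u none
      · rw [if_pos h0, mul_one, monom, AddMonoidAlgebra.coeff_single, Finsupp.single_eq_of_ne,
          mul_zero]
        intro h1
        refine h (Finsupp.ext fun i => ?_)
        cases i with
        | none => exact h0.symm
        | some i => exact_mod_cast (congrFun h1 i).symm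
      · simp [h0]
  | add p q hp hq => rw [map_add, walkCoeff_add, hp, hq, MvPolynomial.coeff_add]

theorem algebraMap_polyRing_injective :
    Function.Injective (algebraMap (PolyRing d) (WalkSeries d)) := by
  intro f g h
  ext m
  rw [← walkCoeff_algebraMap, h, walkCoeff_algebraMap]

/-- The series ring has no zero divisors, so injectivity of the map from polynomials is enough. -/
instance : Module.IsTorsionFree (PolyRing d) (WalkSeries d) := by
  refine Module.IsTorsionFree.comap (algebraMap (PolyRing d) (WalkSeries d)) (S := WalkSeries d)
    (fun r hr => ?_) (fun r m => (Algebra.smul_def r m).symm)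
  exact IsRegular.of_ne_zero (by
    rw [Ne, map_eq_zero_iff _ algebraMap_polyRing_injective]
    exact hr.ne_zero)

theorem coeff_laurentDeriv (i : Fin d) (f : LaurentPoly d) (p : Fin d → ℤ) :
    (laurentDeriv i f).coeff p = ((p i : ℚ) + 1) * f.coeff (p + Pi.single i 1) := by
  rw [laurentDeriv, AddMonoidAlgebra.coeff_finsuppSum, Finsupp.sum_apply]
  simp only [AddMonoidAlgebra.coeff_single]
  rw [Finsupp.sum, Finset.sum_eq_single (p + Pi.single i 1)]
  · simp
  · intro q _ hq
    rw [Finsupp.single_eq_of_ne]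
    rintro rfl
    simp at hq
  · intro h
    rw [Finsupp.notMem_support_iff.1 h]
    simp

theorem laurentDeriv_add (i : Fin d) (f g : LaurentPoly d) :
    laurentDeriv i (f + g) = laurentDeriv i f + laurentDeriv i g :=
  laurentPoly_ext fun p => by
    rw [AddMonoidAlgebra.coeff_add, Finsupp.add_apply]
    simp only [coeff_laurentDeriv, AddMonoidAlgebra.coeff_add, Finsupp.add_apply]
    ring

theorem laurentDeriv_single (i : Fin d) (p : Fin d → ℤ) (c : ℚ) :
    laurentDeriv i (AddMonoidAlgebra.single p c) =
      AddMonoidAlgebra.single (p - Pi.single i 1) ((p i : ℚ) * c) := by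
  rw [laurentDeriv, AddMonoidAlgebra.coeff_single, Finsupp.sum_single_index]
  simp

theorem laurentDeriv_mul (i : Fin d) (f g : LaurentPoly d) :
    laurentDeriv i (f * g) = laurentDeriv i f * g + f * laurentDeriv i g := by
  have h0 : laurentDeriv i (0 : LaurentPoly d) = 0 := by simp [laurentDeriv]
  induction f using AddMonoidAlgebra.induction_linear with
  | zero => simp [h0]
  | add f f' hf hf' => rw [add_mul, laurentDeriv_add, hf, hf', laurentDeriv_add]; ring
  | single p a =>
    induction g using AddMonoidAlgebra.induction_linear with
    | zero => simp [h0]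
    | add g g' hg hg' => rw [mul_add, laurentDeriv_add, hg, hg', laurentDeriv_add]; ring
    | single q b =>
      simp only [AddMonoidAlgebra.single_mul_single, laurentDeriv_single]
      rw [show p - Pi.single i 1 + q = p + q - Pi.single i 1 by abel,
        show p + (q - Pi.single i 1) = p + q - Pi.single i 1 by abel,
        ← AddMonoidAlgebra.single_add]
      congr 1
      push_cast [Pi.add_apply]
      ring

theorem walkCoeff_partialDeriv_none (F : WalkSeries d) (n : ℕ) (p : Fin d → ℤ) :
    walkCoeff (partialDeriv none F) n p = ((n : ℚ) + 1) * walkCoeff F (n + 1) p := by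
  rw [partialDeriv, walkCoeff, PowerSeries.coeff_derivative, walkCoeff, mul_comm,
    show ((n : LaurentPoly d) + 1) = AddMonoidAlgebra.single 0 ((n : ℚ) + 1) by
      rw [AddMonoidAlgebra.single_add, AddMonoidAlgebra.one_def, AddMonoidAlgebra.natCast_def],
    AddMonoidAlgebra.coeff_single_mul_apply]
  simp

theorem walkCoeff_partialDeriv_some (i : Fin d) (F : WalkSeries d) (n : ℕ) (p : Fin d → ℤ) :
    walkCoeff (partialDeriv (some i) F) n p =
      ((p i : ℚ) + 1) * walkCoeff F n (p + Pi.single i 1) := by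
  rw [partialDeriv, walkCoeff, PowerSeries.coeff_mk, coeff_laurentDeriv, walkCoeff]

/-- The partial derivatives of walk series as derivations. -/
def walkDerivation (u : Option (Fin d)) : Derivation ℤ (WalkSeries d) (WalkSeries d) :=
  Derivation.mk' (AddMonoidHom.toIntLinearMap
    { toFun := partialDeriv u
      map_zero' := walkSeries_ext fun n p => by
        cases u
        · rw [walkCoeff_partialDeriv_none]; simp [walkCoeff_zero]
        · rw [walkCoeff_partialDeriv_some]; simp [walkCoeff_zero]
      map_add' := fun F G => walkSeries_ext fun n p => by
        cases u
        · simp only [walkCoeff_add, walkCoeff_partialDeriv_none]; ring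
        · simp only [walkCoeff_add, walkCoeff_partialDeriv_some]; ring })
    (by
      intro F G
      change partialDeriv u (F * G) = F * partialDeriv u G + G * partialDeriv u F
      cases u with
      | none => exact (PowerSeries.derivative (LaurentPoly d)).leibniz F G
      | some i =>
        ext1 n
        simp only [partialDeriv, PowerSeries.coeff_mk, map_add]
        rw [mul_comm G]
        simp only [PowerSeries.coeff_mul, PowerSeries.coeff_mk]
        rw [← Finset.sum_add_distrib]
        have hsum : ∀ (s : Finset (ℕ × ℕ)) (v : ℕ × ℕ → LaurentPoly d),
            laurentDeriv i (∑ j ∈ s, v j) = ∑ j ∈ s, laurentDeriv i (v j) := by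
          intro s v
          induction s using Finset.cons_induction with
          | empty => simp [laurentDeriv]
          | cons a s ha ih => rw [Finset.sum_cons, Finset.sum_cons, laurentDeriv_add, ih]
        rw [hsum]
        exact Finset.sum_congr rfl fun j _ => by rw [laurentDeriv_mul, add_comm])

/-- The partial derivatives of walk series as additive maps. -/
def walkDeriv (u : Option (Fin d)) : WalkSeries d →+ WalkSeries d :=
  (walkDerivation u).toLinearMap.toAddMonoidHom

theorem walkDeriv_apply (u : Option (Fin d)) (F : WalkSeries d) :
    walkDeriv u F = partialDeriv u F := rfl

theorem walkDeriv_mul (u : Option (Fin d)) (F G : WalkSeries d) :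
    walkDeriv u (F * G) = walkDeriv u F * G + F * walkDeriv u G := by
  have := (walkDerivation u).leibniz F G
  rw [smul_eq_mul, smul_eq_mul, mul_comm G, add_comm] at this
  exact this

theorem walkDeriv_C_monom (i : Fin d) (p : Fin d → ℤ) :
    walkDeriv (some i) (PowerSeries.C (monom p)) =
      (p i : ℚ) • PowerSeries.C (monom (p - Pi.single i 1)) := by
  refine PowerSeries.ext fun n => ?_
  have hsmul : ∀ G : WalkSeries d, PowerSeries.coeff n ((p i : ℚ) • G) =
      (p i : ℚ) • PowerSeries.coeff n G := fun _ => rfl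
  rw [walkDeriv_apply, partialDeriv, PowerSeries.coeff_mk, hsmul,
    PowerSeries.coeff_C, PowerSeries.coeff_C]
  split_ifs
  · rw [monom, laurentDeriv_single, monom, AddMonoidAlgebra.smul_single, smul_eq_mul]
  · simp [laurentDeriv]

theorem walkDeriv_C_monom_of_ne {u : Option (Fin d)} {i : Fin d} (hu : u ≠ some i) (k : ℤ) :
    walkDeriv u (PowerSeries.C (monom (Pi.single i k))) = 0 := by
  cases u with
  | none => exact (PowerSeries.derivative_C : PowerSeries.derivative (LaurentPoly d) (PowerSeries.C _) = 0)
  | some j =>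
    have hij : j ≠ i := fun h => hu (by rw [h])
    rw [walkDeriv_C_monom, Pi.single_eq_of_ne hij]
    simp

theorem walkDeriv_variableSeries (u v : Option (Fin d)) :
    walkDeriv u (variableSeries v) =
      algebraMap (PolyRing d) (WalkSeries d) (MvPolynomial.pderiv u (MvPolynomial.X v)) := by
  classical
  rw [MvPolynomial.pderiv_X]
  by_cases h : u = v
  · subst h
    rw [Pi.single_eq_same, map_one]
    cases u with
    | none => exact (PowerSeries.derivative_X : PowerSeries.derivative (LaurentPoly d) _ = 1)
    | some i =>
      rw [variableSeries, walkDeriv_C_monom, Pi.single_eq_same, sub_self, monom_zero]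
      simp
  · rw [Pi.single_eq_of_ne' h, map_zero]
    cases v with
    | none =>
      cases u with
      | none => exact absurd rfl h
      | some i =>
        refine walkSeries_ext fun n p => ?_
        rw [walkDeriv_apply, walkCoeff_partialDeriv_some, walkCoeff_zero, walkCoeff,
          variableSeries, PowerSeries.coeff_X]
        split_ifs
        · rw [AddMonoidAlgebra.one_def, AddMonoidAlgebra.coeff_single]
          by_cases hp : p + Pi.single i 1 = 0
          · have : p i + 1 = 0 := by simpa using congrFun hp i
            rw [show (p i : ℚ) + 1 = ((p i + 1 : ℤ) : ℚ) by push_cast; ring, this]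
            simp
          · rw [Finsupp.single_eq_of_ne hp, mul_zero]
        · simp
    | some i => exact walkDeriv_C_monom_of_ne h 1

theorem walkDeriv_smul (u : Option (Fin d)) (f : PolyRing d) (F : WalkSeries d) :
    walkDeriv u (f • F) = MvPolynomial.pderiv u f • F + f • walkDeriv u F := by
  have h : ∀ f : PolyRing d, walkDeriv u (algebraMap (PolyRing d) (WalkSeries d) f) =
      algebraMap (PolyRing d) (WalkSeries d) (MvPolynomial.pderiv u f) := by
    intro f
    induction f using polyRing_induction with
    | const c =>
      rw [MvPolynomial.pderiv_C, map_zero]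
      refine walkSeries_ext fun n p => ?_
      rw [walkCoeff_zero, algebraMap_polyRing_apply, MvPolynomial.aeval_C,
        Algebra.algebraMap_eq_smul_one, walkDeriv_apply]
      cases u with
      | none =>
        rw [walkCoeff_partialDeriv_none, walkCoeff_smul, walkCoeff, PowerSeries.coeff_one]
        simp
      | some i =>
        rw [walkCoeff_partialDeriv_some, walkCoeff_smul, walkCoeff, PowerSeries.coeff_one]
        split_ifs
        · rw [AddMonoidAlgebra.one_def, AddMonoidAlgebra.coeff_single]
          by_cases hp : p + Pi.single i 1 = 0
          · have : p i + 1 = 0 := by simpa using congrFun hp i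
            rw [show (p i : ℚ) + 1 = ((p i + 1 : ℤ) : ℚ) by push_cast; ring, this]
            simp
          · rw [Finsupp.single_eq_of_ne hp, mul_zero, mul_zero]
        · simp
    | add f g hf hg => simp only [map_add, hf, hg]
    | mul f v hf =>
      rw [map_mul, walkDeriv_mul, hf, algebraMap_polyRing_apply (MvPolynomial.X v),
        MvPolynomial.aeval_X, walkDeriv_variableSeries, Derivation.leibniz, map_add, smul_eq_mul,
        smul_eq_mul, map_mul, map_mul, algebraMap_polyRing_apply (MvPolynomial.X v),
        MvPolynomial.aeval_X]
      ring
  rw [smul_eq_algebraMap_mul, walkDeriv_mul, h, smul_eq_algebraMap_mul, smul_eq_algebraMap_mul]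

theorem isLeibniz_walkDeriv (u : Option (Fin d)) :
    IsLeibniz (MvPolynomial.pderiv u : PolyRing d → PolyRing d) (walkDeriv u) :=
  walkDeriv_smul u

theorem walkDeriv_comm (u v : Option (Fin d)) (F : WalkSeries d) :
    walkDeriv u (walkDeriv v F) = walkDeriv v (walkDeriv u F) := by
  refine walkSeries_ext fun n p => ?_
  simp only [walkDeriv_apply]
  rcases u with _ | i <;> rcases v with _ | j
  · rfl
  · simp only [walkCoeff_partialDeriv_none, walkCoeff_partialDeriv_some]; ring
  · simp only [walkCoeff_partialDeriv_none, walkCoeff_partialDeriv_some]; ring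
  · by_cases h : i = j
    · rw [h]
    · simp only [walkCoeff_partialDeriv_some, Pi.add_apply, Pi.single_eq_of_ne h,
        Pi.single_eq_of_ne' h, add_zero]
      rw [add_right_comm]
      ring

/-! ### D-finiteness in terms of differential equations with polynomial coefficients -/

/-- Linear independence over polynomials would pass to the localized module over the fraction field,
and give an infinite independent family in a finite-dimensional space. -/
theorem IsDFinite.isDiffFinite {F : WalkSeries d} (h : IsDFinite F) (u : Option (Fin d)) :
    IsDiffFinite (PolyRing d) (walkDeriv u) F := by
  refine .of_not_linearIndependent fun hli => ?_
  have h1 := hli.of_isLocalizedModule (FractionRing (PolyRing d)) (nonZeroDivisors (PolyRing d))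
    (LocalizedModule.mkLinearMap (nonZeroDivisors (PolyRing d)) (WalkSeries d))
  have : FiniteDimensional (FractionRing (PolyRing d))
      (Submodule.span (FractionRing (PolyRing d)) (Set.range
        (LocalizedModule.mkLinearMap (nonZeroDivisors (PolyRing d)) (WalkSeries d) ∘
          fun m : ℕ => (walkDeriv u)^[m] F))) := h u
  have : Finite ℕ := (linearIndependent_span h1).finite
  exact not_finite ℕ

/-- Saturation becomes invisible over the fraction field, where the denominators are invertible: the
image of `S` spans a space containing all the derivatives. -/
theorem isDFinite_of_isDiffFinite {F : WalkSeries d}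
    (h : ∀ u, IsDiffFinite (PolyRing d) (walkDeriv u) F) : IsDFinite F := by
  intro u
  obtain ⟨S, hF, hS⟩ := h u
  set K := FractionRing (PolyRing d)
  set f := LocalizedModule.mkLinearMap (nonZeroDivisors (PolyRing d)) (WalkSeries d)
  have hfin : FiniteDimensional K (Submodule.span K (f '' (S : Set (WalkSeries d)))) :=
    FiniteDimensional.span_of_finite K (S.finite_toSet.image f)
  refine Submodule.finiteDimensional_of_le (Submodule.span_le.2 ?_ :
    _ ≤ Submodule.span K (f '' (S : Set (WalkSeries d))))
  rintro _ ⟨m, rfl⟩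
  obtain ⟨q, hq, hqm⟩ := IsDiffFinite.iterate_mem (isLeibniz_walkDeriv u) hF hS m
  have h1 : ∀ x ∈ Submodule.span (PolyRing d) (S : Set (WalkSeries d)),
      f x ∈ Submodule.span K (f '' (S : Set (WalkSeries d))) := by
    intro x hx
    induction hx using Submodule.span_induction with
    | mem x h => exact Submodule.subset_span ⟨x, h, rfl⟩
    | zero => rw [map_zero]; exact zero_mem _
    | add x y _ _ hx hy => rw [map_add]; exact add_mem hx hy
    | smul a x _ hx =>
      rw [map_smul, ← algebraMap_smul K a]
      exact Submodule.smul_mem _ _ hx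
  have h2 := h1 _ hqm
  rw [map_smul, ← algebraMap_smul K q] at h2
  have hq' : algebraMap (PolyRing d) K q ≠ 0 := by
    rwa [Ne, map_eq_zero_iff _ (IsFractionRing.injective (PolyRing d) K)]
  have h3 := Submodule.smul_mem _ (algebraMap (PolyRing d) K q)⁻¹ h2
  rwa [inv_smul_smul₀ hq'] at h3

end Basics

section Slices

variable {d : ℕ}

/-! ### Multiplication by Laurent polynomials -/

theorem exists_polyRing_monom (r : Fin d → ℕ) :
    ∃ f : PolyRing d, f ≠ 0 ∧ ∀ F : WalkSeries d,
      f • F = PowerSeries.C (monom fun i => (r i : ℤ)) * F := by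
  refine ⟨MvPolynomial.monomial
    (Finsupp.equivFunOnFinite.symm fun u : Option (Fin d) => u.elim 0 r) 1, ?_, fun F => ?_⟩
  · rw [Ne, MvPolynomial.monomial_eq_zero]
    exact one_ne_zero
  · rw [smul_eq_algebraMap_mul, algebraMap_polyRing_apply, MvPolynomial.aeval_monomial,
      prod_variableSeries]
    simp

/-- Multiplying x^q by the monomial of its negative exponents leaves the monomial of its positive
exponents, so both factors are polynomials. -/
theorem exists_smul_monom_mul (q : Fin d → ℤ) :
    ∃ f g : PolyRing d, f ≠ 0 ∧ ∀ F : WalkSeries d,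
      f • (PowerSeries.C (monom q) * F) = g • F := by
  obtain ⟨f, hf, hf'⟩ := exists_polyRing_monom fun i => (-q i).toNat
  obtain ⟨g, _, hg'⟩ := exists_polyRing_monom fun i => (q i).toNat
  refine ⟨f, g, hf, fun F => ?_⟩
  rw [hf', hg', ← mul_assoc, ← map_mul, monom_mul_monom]
  congr 3
  ext i
  simp only [Pi.add_apply]
  omega

theorem C_mul_mem_saturation {N : Submodule (PolyRing d) (WalkSeries d)} {F : WalkSeries d}
    (hF : F ∈ saturation N) (f : LaurentPoly d) : PowerSeries.C f * F ∈ saturation N := by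
  induction f using AddMonoidAlgebra.induction_linear with
  | zero => simp
  | add f g hf hg => rw [map_add, add_mul]; exact add_mem hf hg
  | single q c =>
    have h : PowerSeries.C (AddMonoidAlgebra.single q c) * F =
        (MvPolynomial.C c : PolyRing d) • (PowerSeries.C (monom q) * F) := by
      refine walkSeries_ext fun n p => ?_
      rw [C_smul, walkCoeff_smul, walkCoeff_monom_mul, walkCoeff_C_mul,
        AddMonoidAlgebra.coeff_single_mul_apply, neg_add_eq_sub, walkCoeff]
    rw [h]
    obtain ⟨f, g, hf, hfg⟩ := exists_smul_monom_mul q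
    refine Submodule.smul_mem _ _ (mem_saturation_of_smul hf ?_)
    rw [hfg]
    exact Submodule.smul_mem _ _ hF

theorem isDiffFinite_C_mul {D : WalkSeries d →+ WalkSeries d} {F : WalkSeries d}
    (h : IsDiffFinite (PolyRing d) D F) (f : LaurentPoly d) :
    IsDiffFinite (PolyRing d) D (PowerSeries.C f * F) := by
  obtain ⟨S, hF, hS⟩ := h
  exact ⟨S, C_mul_mem_saturation hF f, hS⟩

theorem C_monom_neg_mul_cancel (q : Fin d → ℤ) (F : WalkSeries d) :
    PowerSeries.C (monom (-q)) * (PowerSeries.C (monom q) * F) = F := by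
  rw [← mul_assoc, ← map_mul, monom_mul_monom, neg_add_cancel, monom_zero, map_one, one_mul]

/-! ### Restriction to a set of exponents -/

open Classical in
/-- Keep the monomials of a Laurent polynomial whose exponents are in `E`. -/
def laurentKeep (E : Set (Fin d → ℤ)) (f : LaurentPoly d) : LaurentPoly d :=
  AddMonoidAlgebra.ofCoeff (f.coeff.filter fun p => p ∈ E)

/-- Keep the monomials of a series whose exponents are in `E`. -/
def keep (E : Set (Fin d → ℤ)) (F : WalkSeries d) : WalkSeries d :=
  PowerSeries.mk fun n => laurentKeep E (PowerSeries.coeff n F)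

open Classical in
theorem coeff_laurentKeep (E : Set (Fin d → ℤ)) (f : LaurentPoly d) (p : Fin d → ℤ) :
    (laurentKeep E f).coeff p = if p ∈ E then f.coeff p else 0 := by
  rw [laurentKeep, AddMonoidAlgebra.coeff_ofCoeff, Finsupp.filter_apply]

open Classical in
theorem walkCoeff_keep (E : Set (Fin d → ℤ)) (F : WalkSeries d) (n : ℕ) (p : Fin d → ℤ) :
    walkCoeff (keep E F) n p = if p ∈ E then walkCoeff F n p else 0 := by
  rw [walkCoeff, keep, PowerSeries.coeff_mk, coeff_laurentKeep, walkCoeff]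

theorem nonnegPart_eq_keep (i : Fin d) (F : WalkSeries d) :
    nonnegPart i F = keep {p | 0 ≤ p i} F :=
  walkSeries_ext fun n p => by
    rw [walkCoeff_keep, walkCoeff, nonnegPart, PowerSeries.coeff_mk,
      AddMonoidAlgebra.coeff_ofCoeff, Finsupp.filter_apply, walkCoeff]
    simp only [Set.mem_ofPred_eq]
    congr

/-- The part of degree `j` in `xᵢ` of a series. -/
def slice (i : Fin d) (j : ℤ) (F : WalkSeries d) : WalkSeries d := keep {p | p i = j} F

theorem walkCoeff_slice (i : Fin d) (j : ℤ) (F : WalkSeries d) (n : ℕ) (p : Fin d → ℤ) :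
    walkCoeff (slice i j F) n p = if p i = j then walkCoeff F n p else 0 := by
  rw [slice, walkCoeff_keep]
  simp only [Set.mem_ofPred_eq]
  split_ifs <;> rfl

theorem slice_add (i : Fin d) (j : ℤ) (F G : WalkSeries d) :
    slice i j (F + G) = slice i j F + slice i j G :=
  walkSeries_ext fun n p => by
    simp only [walkCoeff_slice, walkCoeff_add]
    split_ifs <;> simp

theorem slice_zero (i : Fin d) (j : ℤ) : slice i j (0 : WalkSeries d) = 0 :=
  walkSeries_ext fun n p => by simp [walkCoeff_slice, walkCoeff_zero]

theorem slice_C_smul (i : Fin d) (j : ℤ) (c : ℚ) (F : WalkSeries d) :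
    slice i j ((MvPolynomial.C c : PolyRing d) • F) =
      (MvPolynomial.C c : PolyRing d) • slice i j F :=
  walkSeries_ext fun n p => by
    simp only [C_smul, walkCoeff_slice, walkCoeff_smul]
    split_ifs <;> simp

theorem slice_X_smul_self (i : Fin d) (j : ℤ) (F : WalkSeries d) :
    slice i j ((MvPolynomial.X (some i) : PolyRing d) • F) =
      (MvPolynomial.X (some i) : PolyRing d) • slice i (j - 1) F :=
  walkSeries_ext fun n p => by
    simp only [walkCoeff_slice, walkCoeff_X_some_smul, Pi.sub_apply, Pi.single_eq_same,
      sub_left_inj]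

theorem slice_X_smul_of_ne {i : Fin d} {u : Option (Fin d)} (hu : u ≠ some i) (j : ℤ)
    (F : WalkSeries d) :
    slice i j ((MvPolynomial.X u : PolyRing d) • F) =
      (MvPolynomial.X u : PolyRing d) • slice i j F := by
  refine walkSeries_ext fun n p => ?_
  rcases u with _ | k
  · cases n with
    | zero => simp only [walkCoeff_slice, walkCoeff_X_none_smul_zero, ite_self]
    | succ n => simp only [walkCoeff_slice, walkCoeff_X_none_smul_succ]
  · have hk : i ≠ k := fun h => hu (by rw [h])
    simp only [walkCoeff_slice, walkCoeff_X_some_smul, Pi.sub_apply, Pi.single_eq_of_ne hk,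
      sub_zero]

theorem slice_monom_mul (i : Fin d) (j k : ℤ) (F : WalkSeries d) :
    slice i j (PowerSeries.C (monom (Pi.single i k)) * F) =
      PowerSeries.C (monom (Pi.single i k)) * slice i (j - k) F :=
  walkSeries_ext fun n p => by
    simp only [walkCoeff_slice, walkCoeff_monom_mul, Pi.sub_apply, Pi.single_eq_same,
      sub_left_inj]

theorem slice_walkDeriv_of_ne {i : Fin d} {u : Option (Fin d)} (hu : u ≠ some i) (j : ℤ)
    (F : WalkSeries d) : slice i j (walkDeriv u F) = walkDeriv u (slice i j F) := by
  refine walkSeries_ext fun n p => ?_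
  rcases u with _ | k
  · simp only [walkCoeff_slice, walkDeriv_apply, walkCoeff_partialDeriv_none]
    split_ifs <;> simp
  · have hk : i ≠ k := fun h => hu (by rw [h])
    simp only [walkCoeff_slice, walkDeriv_apply, walkCoeff_partialDeriv_some, Pi.add_apply,
      Pi.single_eq_of_ne hk, add_zero]
    split_ifs <;> simp

theorem slice_iterate_walkDeriv_of_ne {i : Fin d} {u : Option (Fin d)} (hu : u ≠ some i) (j : ℤ)
    (m : ℕ) (F : WalkSeries d) :
    slice i j ((walkDeriv u)^[m] F) = (walkDeriv u)^[m] (slice i j F) := by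
  induction m with
  | zero => rfl
  | succ m ih =>
    rw [Function.iterate_succ_apply', Function.iterate_succ_apply', slice_walkDeriv_of_ne hu, ih]

/-- A derivative has no residue: the term in xᵢ⁻¹ would come from xᵢ⁰, with factor 0. -/
theorem slice_neg_one_walkDeriv (i : Fin d) (F : WalkSeries d) :
    slice i (-1) (walkDeriv (some i) F) = 0 := by
  refine walkSeries_ext fun n p => ?_
  rw [walkCoeff_slice, walkDeriv_apply, walkCoeff_partialDeriv_some, walkCoeff_zero]
  split_ifs with h
  · rw [h]; simp
  · rfl

/-- On negative exponents the derivative is injective: it multiplies by the exponent, which is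
nonzero, and lowers it, hence keeps it negative. The induction thus only follows coefficients with
negative exponent. -/
theorem slice_neg_one_of_iterate_walkDeriv_eq_zero (i : Fin d) (m : ℕ) (F : WalkSeries d)
    (h : (walkDeriv (some i))^[m] F = 0) : slice i (-1) F = 0 := by
  have key : ∀ m (F : WalkSeries d),
      (∀ n p, p i < 0 → walkCoeff ((walkDeriv (some i))^[m] F) n p = 0) →
      ∀ n p, p i < 0 → walkCoeff F n p = 0 := by
    intro m
    induction m with
    | zero => exact fun F h => h
    | succ m ih =>
      intro F h n p hp
      have h1 := ih (walkDeriv (some i) F) h n (p - Pi.single i 1) (by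
        rw [Pi.sub_apply, Pi.single_eq_same]; omega)
      rw [walkDeriv_apply, walkCoeff_partialDeriv_some, sub_add_cancel, Pi.sub_apply,
        Pi.single_eq_same] at h1
      push_cast at h1
      rw [sub_add_cancel] at h1
      refine (mul_eq_zero.1 h1).resolve_left ?_
      exact_mod_cast hp.ne
  refine walkSeries_ext fun n p => ?_
  rw [walkCoeff_slice, walkCoeff_zero]
  split_ifs with hp
  · exact key m F (fun n p _ => by rw [h, walkCoeff_zero]) n p (by omega)
  · rfl

/-- All the slices of F are required at once, since multiplication by xᵢ shifts their index. -/
theorem slice_smul_mem {i : Fin d} {N : Submodule (PolyRing d) (WalkSeries d)} {F : WalkSeries d}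
    (hF : ∀ j, slice i j F ∈ N) (f : PolyRing d) : ∀ j, slice i j (f • F) ∈ N := by
  induction f using polyRing_induction with
  | const c => intro j; rw [slice_C_smul]; exact N.smul_mem _ (hF j)
  | add f g hf hg => intro j; rw [add_smul, slice_add]; exact N.add_mem (hf j) (hg j)
  | mul f u hf =>
    intro j
    rw [mul_smul]
    by_cases hu : u = some i
    · subst hu
      rw [slice_X_smul_self]
      exact N.smul_mem _ (hf _)
    · rw [slice_X_smul_of_ne hu]
      exact N.smul_mem _ (hf _)

/-- A series G homogeneous of degree j in xᵢ satisfies ∂G/∂xᵢ = j xᵢ⁻¹ G, whatever its dependence on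
the other variables. -/
theorem isDiffFinite_slice_self (i : Fin d) (j : ℤ) (F : WalkSeries d) :
    IsDiffFinite (PolyRing d) (walkDeriv (some i)) (slice i j F) := by
  refine ⟨{slice i j F}, mem_saturation_span (by simp), fun e he => ?_⟩
  rw [Finset.mem_singleton] at he
  subst he
  have : walkDeriv (some i) (slice i j F) = (MvPolynomial.C (j : ℚ) : PolyRing d) •
      (PowerSeries.C (monom (Pi.single i (-1))) * slice i j F) := by
    refine walkSeries_ext fun n p => ?_
    rw [walkDeriv_apply, walkCoeff_partialDeriv_some, C_smul, walkCoeff_smul, walkCoeff_monom_mul,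
      Pi.single_neg, sub_neg_eq_add, walkCoeff_slice, Pi.add_apply, Pi.single_eq_same]
    split_ifs with h
    · rw [← h]; push_cast; ring
    · simp
  rw [this]
  exact Submodule.smul_mem _ _ (C_mul_mem_saturation (mem_saturation_span (by simp)) _)

/-! ### Polynomials without one of the variables -/

/-- The polynomials which do not involve the variable `xᵢ`. -/
abbrev polyRingWithout (i : Fin d) : Subalgebra ℚ (PolyRing d) :=
  MvPolynomial.supported ℚ {u | u ≠ some i}

theorem polyRingWithout_induction {i : Fin d} {motive : PolyRing d → Prop}
    (const : ∀ c : ℚ, motive (MvPolynomial.C c))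
    (X : ∀ u, u ≠ some i → motive (MvPolynomial.X u))
    (add : ∀ f g, motive f → motive g → motive (f + g))
    (mul : ∀ f g, motive f → motive g → motive (f * g))
    (a : polyRingWithout i) : motive a := by
  obtain ⟨a, ha⟩ := a
  change a ∈ Algebra.adjoin ℚ (MvPolynomial.X '' {u | u ≠ some i}) at ha
  induction ha using Algebra.adjoin_induction with
  | mem x h => obtain ⟨u, hu, rfl⟩ := h; exact X u hu
  | algebraMap r => exact const r
  | add x y _ _ hx hy => exact add _ _ hx hy
  | mul x y _ _ hx hy => exact mul _ _ hx hy

theorem pderiv_mem_polyRingWithout {i : Fin d} (u : Option (Fin d)) (a : polyRingWithout i) :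
    MvPolynomial.pderiv u (a : PolyRing d) ∈ polyRingWithout i := by
  obtain ⟨a, ha⟩ := a
  simp only
  induction ha using Algebra.adjoin_induction with
  | mem x h =>
    obtain ⟨v, hv, rfl⟩ := h
    classical
    rw [MvPolynomial.pderiv_X]
    by_cases huv : u = v
    · subst huv; rw [Pi.single_eq_same]; exact one_mem _
    · rw [Pi.single_eq_of_ne' huv]; exact zero_mem _
  | algebraMap r =>
    rw [MvPolynomial.algebraMap_eq, MvPolynomial.pderiv_C]; exact zero_mem _
  | add x y _ _ hx hy => rw [map_add]; exact add_mem hx hy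
  | mul x y hx' hy' hx hy =>
    rw [Derivation.leibniz, smul_eq_mul, smul_eq_mul]
    exact add_mem (mul_mem hx' hy) (mul_mem hy' hx)

theorem pderiv_polyRingWithout {i : Fin d} (a : polyRingWithout i) :
    MvPolynomial.pderiv (some i) (a : PolyRing d) = 0 := by
  refine polyRingWithout_induction (motive := fun f => MvPolynomial.pderiv (some i) f = 0)
    (fun c => MvPolynomial.pderiv_C) (fun u hu => ?_)
    (fun f g hf hg => by rw [map_add, hf, hg, add_zero])
    (fun f g hf hg => by rw [Derivation.leibniz, hf, hg, smul_zero, smul_zero, add_zero]) a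
  exact MvPolynomial.pderiv_X_of_ne hu

theorem exists_mem_degreeFiltration (i : Fin d) (f : PolyRing d) :
    ∃ c, f ∈ degreeFiltration (polyRingWithout i) (MvPolynomial.X (some i) : PolyRing d) c := by
  induction f using polyRing_induction with
  | const c =>
    exact ⟨0, algebraMap_mem_degreeFiltration (A := polyRingWithout i) _
      (algebraMap ℚ (polyRingWithout i) c) 0⟩
  | add f g hf hg =>
    obtain ⟨a, ha⟩ := hf
    obtain ⟨b, hb⟩ := hg
    exact ⟨max a b, add_mem (degreeFiltration_mono _ (le_max_left _ _) ha)
      (degreeFiltration_mono _ (le_max_right _ _) hb)⟩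
  | mul f u hf =>
    obtain ⟨a, ha⟩ := hf
    refine ⟨1 + a, mul_mem_degreeFiltration ?_ ha⟩
    by_cases hu : u = some i
    · subst hu
      simpa using pow_mem_degreeFiltration (A := polyRingWithout i)
        (MvPolynomial.X (some i) : PolyRing d) (le_refl 1)
    · exact algebraMap_mem_degreeFiltration (A := polyRingWithout i) _
        ⟨MvPolynomial.X u, Algebra.subset_adjoin ⟨u, hu, rfl⟩⟩ 1

theorem pderiv_mem_degreeFiltration (i : Fin d) (u : Option (Fin d)) (c : ℕ) (f : PolyRing d)
    (hf : f ∈ degreeFiltration (polyRingWithout i) (MvPolynomial.X (some i) : PolyRing d) c) :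
    MvPolynomial.pderiv u f ∈
      degreeFiltration (polyRingWithout i) (MvPolynomial.X (some i) : PolyRing d) c := by
  classical
  induction hf using Submodule.span_induction with
  | mem x h =>
    obtain ⟨k, hk, rfl⟩ := h
    simp only [Set.mem_ofPred_eq] at hk
    rw [Derivation.leibniz_pow, MvPolynomial.pderiv_X]
    by_cases hu : u = some i
    · subst hu
      rw [Pi.single_eq_same, smul_eq_mul, mul_one]
      exact nsmul_mem (pow_mem_degreeFiltration _ (by omega)) _
    · rw [Pi.single_eq_of_ne' hu, smul_zero, smul_zero]
      exact zero_mem _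
  | zero => rw [map_zero]; exact zero_mem _
  | add x y _ _ hx hy => rw [map_add]; exact add_mem hx hy
  | smul a x hx' hx =>
    have h1 : a • x = (a : PolyRing d) * x := rfl
    rw [h1, Derivation.leibniz, smul_eq_mul, smul_eq_mul]
    refine add_mem (Submodule.smul_mem _ a hx) ?_
    rw [mul_comm]
    exact Submodule.smul_mem _ (⟨_, pderiv_mem_polyRingWithout u a⟩ : polyRingWithout i) hx'

theorem slice_polyRingWithout_smul {i : Fin d} (j : ℤ) (a : polyRingWithout i)
    (F : WalkSeries d) : slice i j (a • F) = a • slice i j F := by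
  have h : ∀ F, slice i j ((a : PolyRing d) • F) = (a : PolyRing d) • slice i j F := by
    refine polyRingWithout_induction
      (motive := fun f => ∀ F, slice i j (f • F) = f • slice i j F) (fun c F => slice_C_smul i j c F)
      (fun u hu F => slice_X_smul_of_ne hu j F) (fun f g hf hg F => ?_) (fun f g hf hg F => ?_) a
    · rw [add_smul, slice_add, hf, hg, add_smul]
    · rw [mul_smul, hf, hg, mul_smul]
  exact h F

/-! ### Coefficient extraction and positive parts of D-finite series -/

/-- Creative telescoping, with the extraction of xᵢ⁻¹ as residue map. Finiteness with respect to xᵢ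
is needed even though the conclusion concerns u: the elimination uses a module stable under both
derivatives. -/
theorem isDiffFinite_slice {i : Fin d} {u : Option (Fin d)} (hu : u ≠ some i) {F : WalkSeries d}
    (hi : IsDiffFinite (PolyRing d) (walkDeriv (some i)) F)
    (hF : IsDiffFinite (PolyRing d) (walkDeriv u) F) (j : ℤ) :
    IsDiffFinite (PolyRing d) (walkDeriv u) (slice i j F) := by
  have key : ∀ {F : WalkSeries d}, IsDiffFinite (PolyRing d) (walkDeriv (some i)) F →
      IsDiffFinite (PolyRing d) (walkDeriv u) F →
      IsDiffFinite (PolyRing d) (walkDeriv u) (slice i (-1) F) := by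
    intro F hi hF
    obtain ⟨S, hFS, hS₁, hS₂⟩ := hi.joint (isLeibniz_walkDeriv (some i)) (isLeibniz_walkDeriv u)
      (walkDeriv_comm (some i) u) hF
    have h1 := not_linearIndependent_iterate_iterate (A := polyRingWithout i)
      (exists_mem_degreeFiltration i) (isLeibniz_walkDeriv (some i)) (isLeibniz_walkDeriv u)
      (pderiv_mem_degreeFiltration i (some i)) (pderiv_mem_degreeFiltration i u) hFS hS₁ hS₂
    let D : WalkSeries d →ₗ[polyRingWithout i] WalkSeries d :=
      { walkDeriv (some i) with
        map_smul' := fun a F => by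
          change walkDeriv (some i) ((a : PolyRing d) • F) = (a : PolyRing d) • walkDeriv (some i) F
          rw [walkDeriv_smul, pderiv_polyRingWithout, zero_smul, zero_add] }
    let ρ : WalkSeries d →ₗ[polyRingWithout i] WalkSeries d :=
      { toFun := slice i (-1)
        map_add' := slice_add i (-1)
        map_smul' := slice_polyRingWithout_smul (-1) }
    have h2 := not_linearIndependent_residue (D₁ := D) (ρ := ρ) (D₂ := walkDeriv u)
      (slice_neg_one_walkDeriv i) (slice_walkDeriv_of_ne hu (-1))
      (slice_neg_one_of_iterate_walkDeriv_eq_zero i) h1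
    refine .of_not_linearIndependent fun hli => h2 ?_
    refine hli.restrict_scalars fun a b hab => ?_
    simpa [Subalgebra.smul_def] using hab
  -- Multiplication by xᵢ^(-1-j) moves the slice of degree j to degree -1.
  have h := key (isDiffFinite_C_mul hi (monom (Pi.single i (-1 - j))))
    (isDiffFinite_C_mul hF (monom (Pi.single i (-1 - j))))
  rw [slice_monom_mul, sub_sub_cancel] at h
  have h' := isDiffFinite_C_mul h (monom (-Pi.single i (-1 - j)))
  rwa [C_monom_neg_mul_cancel] at h'

/-- The series whose exponents of `xᵢ` are bounded below (for `ε = 1`) or above (for `ε = -1`). -/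
def boundedSubmodule (i : Fin d) (ε : ℤ) : Submodule (PolyRing d) (WalkSeries d) where
  carrier := {F | ∃ b : ℤ, ∀ n p, ε * p i < b → walkCoeff F n p = 0}
  add_mem' := by
    rintro F G ⟨a, ha⟩ ⟨b, hb⟩
    refine ⟨min a b, fun n p hp => ?_⟩
    rw [walkCoeff_add, ha n p (hp.trans_le (min_le_left _ _)),
      hb n p (hp.trans_le (min_le_right _ _)), add_zero]
  zero_mem' := ⟨0, fun n p _ => walkCoeff_zero n p⟩
  smul_mem' := by
    rintro f F hF
    induction f using polyRing_induction with
    | const c =>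
      obtain ⟨b, hb⟩ := hF
      exact ⟨b, fun n p hp => by rw [C_smul, walkCoeff_smul, hb n p hp, mul_zero]⟩
    | add f g hf hg =>
      obtain ⟨a, ha⟩ := hf
      obtain ⟨b, hb⟩ := hg
      refine ⟨min a b, fun n p hp => ?_⟩
      rw [add_smul, walkCoeff_add, ha n p (hp.trans_le (min_le_left _ _)),
        hb n p (hp.trans_le (min_le_right _ _)), add_zero]
    | mul f u hf =>
      obtain ⟨b, hb⟩ := hf
      rcases u with _ | k
      · refine ⟨b, fun n p hp => ?_⟩
        rw [mul_smul]
        cases n with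
        | zero => rw [walkCoeff_X_none_smul_zero]
        | succ n => rw [walkCoeff_X_none_smul_succ, hb n p hp]
      · refine ⟨b - |ε|, fun n p hp => ?_⟩
        rw [mul_smul, walkCoeff_X_some_smul]
        refine hb n _ ?_
        rw [Pi.sub_apply]
        have h1 := neg_abs_le ε
        have h2 := abs_nonneg ε
        by_cases hk : i = k
        · subst hk; rw [Pi.single_eq_same, mul_sub]; omega
        · rw [Pi.single_eq_of_ne hk, sub_zero]; omega

theorem walkDeriv_mem_boundedSubmodule {i : Fin d} {ε : ℤ} (u : Option (Fin d))
    {F : WalkSeries d} (hF : F ∈ boundedSubmodule i ε) : walkDeriv u F ∈ boundedSubmodule i ε := by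
  obtain ⟨b, hb⟩ := hF
  rcases u with _ | k
  · refine ⟨b, fun n p hp => ?_⟩
    rw [walkDeriv_apply, walkCoeff_partialDeriv_none, hb _ p hp, mul_zero]
  · refine ⟨b - |ε|, fun n p hp => ?_⟩
    rw [walkDeriv_apply, walkCoeff_partialDeriv_some, hb, mul_zero]
    rw [Pi.add_apply]
    have h1 := le_abs_self ε
    have h2 := abs_nonneg ε
    by_cases hk : i = k
    · subst hk; rw [Pi.single_eq_same, mul_add]; omega
    · rw [Pi.single_eq_of_ne hk, add_zero]; omega

theorem iterate_walkDeriv_mem_boundedSubmodule {i : Fin d} {ε : ℤ} (u : Option (Fin d))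
    {F : WalkSeries d} (hF : F ∈ boundedSubmodule i ε) (m : ℕ) :
    (walkDeriv u)^[m] F ∈ boundedSubmodule i ε := by
  induction m with
  | zero => exact hF
  | succ m ih =>
    rw [Function.iterate_succ_apply']; exact walkDeriv_mem_boundedSubmodule u ih

/-- The bounds on the exponent of xᵢ are uniform in the power of t, so the series is a finite sum of
its slices. -/
theorem mem_of_slice_mem {i : Fin d} {N : Submodule (PolyRing d) (WalkSeries d)}
    {F : WalkSeries d} (h₁ : F ∈ boundedSubmodule i 1) (h₂ : F ∈ boundedSubmodule i (-1))
    (hN : ∀ j, slice i j F ∈ N) : F ∈ N := by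
  obtain ⟨a, ha⟩ := h₁
  obtain ⟨b, hb⟩ := h₂
  have h : F = ∑ j ∈ Finset.Icc a (-b), slice i j F := by
    refine walkSeries_ext fun n p => ?_
    have hsum : walkCoeff (∑ j ∈ Finset.Icc a (-b), slice i j F) n p =
        ∑ j ∈ Finset.Icc a (-b), walkCoeff (slice i j F) n p := by
      simp [walkCoeff, AddMonoidAlgebra.coeff_sum]
    rw [hsum]
    simp only [walkCoeff_slice, Finset.sum_ite_eq, Finset.mem_Icc]
    split_ifs with hp
    · rfl
    · rcases not_and_or.1 hp with hp | hp
      · exact ha n p (by omega)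
      · exact hb n p (by omega)
  rw [h]
  exact sum_mem fun j _ => hN j

/-- The positive part of a D-finite series is D-finite. -/
theorem isDiffFinite_nonnegPart (i : Fin d) {F : WalkSeries d}
    (h : ∀ u, IsDiffFinite (PolyRing d) (walkDeriv u) F) (u : Option (Fin d)) :
    IsDiffFinite (PolyRing d) (walkDeriv u) (nonnegPart i F) := by
  have hli := (h u).not_linearIndependent (isLeibniz_walkDeriv u)
  rw [linearIndependent_iff] at hli
  push Not at hli
  obtain ⟨p, hp, hp0⟩ := hli
  rw [Finsupp.linearCombination_apply] at hp
  -- Let L be the operator with coefficients p, so that LF = 0. The goal becomes finiteness of L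
  -- applied to the nonnegative part, which is checked slice by slice once its exponents are known
  -- to be bounded.
  refine .of_equation p hp0 ?_
  refine (mem_diffFiniteSubmodule (D := walkDeriv u)).1 (mem_of_slice_mem (i := i) ?_ ?_ ?_)
  · refine sum_mem fun m _ => Submodule.smul_mem _ _ (iterate_walkDeriv_mem_boundedSubmodule u ?_ m)
    refine ⟨0, fun n q hq => ?_⟩
    rw [nonnegPart_eq_keep, walkCoeff_keep, if_neg]
    simp only [Set.mem_ofPred_eq]
    omega
  -- The upper bound on exponents comes from the complementary part F - F⁺, which only has exponents
  -- of xᵢ at most -1.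
  · have heq : (p.sum fun m c => c • (walkDeriv u)^[m] (nonnegPart i F)) =
        -(p.sum fun m c => c • (walkDeriv u)^[m] (F - nonnegPart i F)) := by
      rw [eq_neg_iff_add_eq_zero, ← hp, Finsupp.sum, Finsupp.sum, ← Finset.sum_add_distrib]
      refine Finset.sum_congr rfl fun m _ => ?_
      rw [← smul_add, ← iterate_map_add, add_sub_cancel]
    rw [heq]
    refine neg_mem (sum_mem fun m _ =>
      Submodule.smul_mem _ _ (iterate_walkDeriv_mem_boundedSubmodule u ?_ m))
    refine ⟨1, fun n q hq => ?_⟩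
    rw [walkCoeff_sub, nonnegPart_eq_keep, walkCoeff_keep, if_pos, sub_self]
    simp only [Set.mem_ofPred_eq]
    omega
  · intro j
    by_cases hu : u = some i
    · subst hu
      exact isDiffFinite_slice_self i j _
    · have hsum : ∀ s : Finset ℕ,
          slice i j (∑ m ∈ s, p m • (walkDeriv u)^[m] (nonnegPart i F)) =
            ∑ m ∈ s, slice i j (p m • (walkDeriv u)^[m] (nonnegPart i F)) := by
        intro s
        induction s using Finset.cons_induction with
        | empty => exact slice_zero i j
        | cons a s ha ih => rw [Finset.sum_cons, Finset.sum_cons, slice_add, ih]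
      rw [Finsupp.sum, hsum]
      refine sum_mem fun m _ => slice_smul_mem (fun k => ?_) (p m) j
      rw [slice_iterate_walkDeriv_of_ne hu]
      refine IsDiffFinite.iterate (isLeibniz_walkDeriv u) ?_ m
      by_cases hk : 0 ≤ k
      · have : slice i k (nonnegPart i F) = slice i k F := walkSeries_ext fun n q => by
          simp only [walkCoeff_slice, nonnegPart_eq_keep, walkCoeff_keep, Set.mem_ofPred_eq]
          split_ifs with h1 h2
          · rfl
          · omega
          · rfl
        rw [this]
        exact isDiffFinite_slice hu (h (some i)) (h u) k
      · have : slice i k (nonnegPart i F) = 0 := walkSeries_ext fun n q => by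
          simp only [walkCoeff_slice, nonnegPart_eq_keep, walkCoeff_keep, Set.mem_ofPred_eq,
            walkCoeff_zero]
          split_ifs with h1 h2
          · omega
          · rfl
          · rfl
        rw [this]
        exact zero_mem (diffFiniteSubmodule (PolyRing d) (walkDeriv u))

end Slices

section Substitution

variable {d : ℕ}

/-! ### Series which are rational -/

theorem mul_mem_saturation {c F : WalkSeries d} {N : Submodule (PolyRing d) (WalkSeries d)}
    (hc : c ∈ saturation (Submodule.span (PolyRing d) {(1 : WalkSeries d)}))
    (hF : F ∈ saturation N) : c * F ∈ saturation N := by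
  obtain ⟨q, hq, hqc⟩ := hc
  obtain ⟨f, hf⟩ := Submodule.mem_span_singleton.1 hqc
  refine mem_saturation_of_smul hq ?_
  rw [← smul_mul_assoc, ← hf, smul_one_mul]
  exact Submodule.smul_mem _ _ hF

/-- Membership of c in the saturation of the span of 1 means that c is rational: q c = f with
polynomials q and f, both nonzero. Then f F = q (c F), and f can be divided out. -/
theorem mem_saturation_of_mul {c F : WalkSeries d} {N : Submodule (PolyRing d) (WalkSeries d)}
    (hc : c ∈ saturation (Submodule.span (PolyRing d) {(1 : WalkSeries d)})) (hc0 : c ≠ 0)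
    (hF : c * F ∈ saturation N) : F ∈ saturation N := by
  obtain ⟨q, hq, hqc⟩ := hc
  obtain ⟨f, hf⟩ := Submodule.mem_span_singleton.1 hqc
  have hf0 : f ≠ 0 := by
    rintro rfl
    rw [zero_smul] at hf
    exact (smul_ne_zero hq hc0) hf.symm
  refine mem_saturation_of_smul hf0 ?_
  rw [← smul_one_mul, hf, smul_mul_assoc]
  exact Submodule.smul_mem _ _ hF

/-! ### The substitution of `xᵢ + 1 / xᵢ` for `xᵢ` -/

/-- The monomial case is only asked for exponents in the support of f, so a condition on these
exponents remains available there. -/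
theorem laurentPoly_support_induction {motive : LaurentPoly d → Prop} (f : LaurentPoly d)
    (zero : motive 0) (add : ∀ f g, motive f → motive g → motive (f + g))
    (single : ∀ p, f.coeff p ≠ 0 → ∀ c, motive (AddMonoidAlgebra.single p c)) : motive f := by
  rw [← AddMonoidAlgebra.sum_coeff_single f]
  exact Finset.sum_induction _ motive add zero fun p hp => single p (Finsupp.mem_support_iff.1 hp) _

/-- The Laurent polynomial `xᵢ + 1 / xᵢ`. -/
def symVar (i : Fin d) : LaurentPoly d := monom (Pi.single i 1) + monom (Pi.single i (-1))

/-- The substitution of `xᵢ + 1 / xᵢ` for `xᵢ` in Laurent polynomials (meaningful for nonnegative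
exponents of `xᵢ`). -/
def laurentSubst (i : Fin d) : LaurentPoly d →+ LaurentPoly d where
  toFun f := f.coeff.sum fun p c =>
    (AddMonoidAlgebra.single (p - Pi.single i (p i)) c * symVar i ^ (p i).toNat : LaurentPoly d)
  map_zero' := Finsupp.sum_zero_index
  map_add' f g := by
    rw [AddMonoidAlgebra.coeff_add, Finsupp.sum_add_index']
    · intro p
      rw [AddMonoidAlgebra.single_zero, zero_mul]
    · intro p a b
      rw [AddMonoidAlgebra.single_add, add_mul]

theorem laurentSubst_single (i : Fin d) (p : Fin d → ℤ) (c : ℚ) :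
    laurentSubst i (AddMonoidAlgebra.single p c) =
      AddMonoidAlgebra.single (p - Pi.single i (p i)) c * symVar i ^ (p i).toNat := by
  change (AddMonoidAlgebra.single p c).coeff.sum (fun p c =>
    (AddMonoidAlgebra.single (p - Pi.single i (p i)) c * symVar i ^ (p i).toNat :
      LaurentPoly d)) = _
  rw [AddMonoidAlgebra.coeff_single, Finsupp.sum_single_index]
  simp

theorem laurentSubst_monom_of_eq_zero {i : Fin d} {p : Fin d → ℤ} (hp : p i = 0) :
    laurentSubst i (monom p) = monom p := by
  rw [monom, laurentSubst_single, hp, Pi.single_zero, sub_zero, Int.toNat_zero, pow_zero, mul_one]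

theorem laurentSubst_monom_single (i : Fin d) :
    laurentSubst i (monom (Pi.single i 1)) = symVar i := by
  rw [monom, laurentSubst_single, Pi.single_eq_same, sub_self, Int.toNat_one, pow_one,
    ← AddMonoidAlgebra.one_def, one_mul]

/-- The truncation of exponents to natural numbers is additive on nonnegative exponents only, whence
the two hypotheses. -/
theorem laurentSubst_mul {i : Fin d} {f g : LaurentPoly d} (hf : ∀ p, p i < 0 → f.coeff p = 0)
    (hg : ∀ p, p i < 0 → g.coeff p = 0) :
    laurentSubst i (f * g) = laurentSubst i f * laurentSubst i g := by
  refine laurentPoly_support_induction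
    (motive := fun f => laurentSubst i (f * g) = laurentSubst i f * laurentSubst i g) f
    (by simp) (fun f f' h h' => by rw [add_mul, map_add, h, h', map_add, add_mul]) fun p hp a => ?_
  refine laurentPoly_support_induction (motive := fun g => laurentSubst i
    (AddMonoidAlgebra.single p a * g) = laurentSubst i (AddMonoidAlgebra.single p a) *
      laurentSubst i g) g
    (by simp) (fun f f' h h' => by rw [mul_add, map_add, h, h', map_add, mul_add]) fun q hq b => ?_
  have hp' : 0 ≤ p i := not_lt.1 fun h => hp (hf p h)
  have hq' : 0 ≤ q i := not_lt.1 fun h => hq (hg q h)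
  rw [AddMonoidAlgebra.single_mul_single, laurentSubst_single, laurentSubst_single,
    laurentSubst_single, Pi.add_apply, Int.toNat_add hp' hq', pow_add, mul_mul_mul_comm,
    AddMonoidAlgebra.single_mul_single, Pi.single_add, add_sub_add_comm]

theorem coeff_monom_mul_symVar_pow (i : Fin d) (k : ℕ) (q p : Fin d → ℤ) (h : q i + k ≤ p i) :
    (monom q * symVar i ^ k).coeff p = (monom (q + Pi.single i (k : ℤ))).coeff p := by
  induction k generalizing q with
  | zero => simp
  | succ k ih =>
    push_cast at h
    rw [pow_succ', ← mul_assoc, symVar, mul_add, monom_mul_monom, monom_mul_monom, ← symVar,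
      add_mul, AddMonoidAlgebra.coeff_add, Finsupp.add_apply,
      ih _ (by rw [Pi.add_apply, Pi.single_eq_same]; omega),
      ih _ (by rw [Pi.add_apply, Pi.single_eq_same]; omega)]
    have h0 : (monom (q + Pi.single i (-1) + Pi.single i (k : ℤ)) : LaurentPoly d).coeff p = 0 := by
      rw [monom, AddMonoidAlgebra.coeff_single, Finsupp.single_eq_of_ne]
      rintro rfl
      simp only [Pi.add_apply, Pi.single_eq_same] at h
      omega
    rw [h0, add_zero, add_assoc, ← Pi.single_add]
    push_cast
    rw [add_comm (1 : ℤ)]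

/-- In (x + 1/x)^k the top term is x^k with coefficient 1 and all others have lower degree.
Coefficients in top degree are therefore unchanged, which makes the substitution injective. -/
theorem coeff_laurentSubst {i : Fin d} {f : LaurentPoly d} (hf : ∀ p, p i < 0 → f.coeff p = 0)
    (p : Fin d → ℤ) (hp : ∀ q, f.coeff q ≠ 0 → q i ≤ p i) :
    (laurentSubst i f).coeff p = f.coeff p := by
  refine laurentPoly_support_induction
    (motive := fun f => (laurentSubst i f).coeff p = f.coeff p) f (by simp)
    (fun f g h h' => ?_) fun q hq c => ?_
  · rw [map_add, AddMonoidAlgebra.coeff_add, Finsupp.add_apply, h, h', AddMonoidAlgebra.coeff_add,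
      Finsupp.add_apply]
  · have hq' : 0 ≤ q i := not_lt.1 fun h => hq (hf q h)
    have hs : ∀ r : Fin d → ℤ, (AddMonoidAlgebra.single r c : LaurentPoly d) = c • monom r :=
      fun r => by rw [monom, AddMonoidAlgebra.smul_single, smul_eq_mul, mul_one]
    rw [laurentSubst_single, hs, hs, smul_mul_assoc, AddMonoidAlgebra.coeff_smul_apply,
      coeff_monom_mul_symVar_pow, Int.toNat_of_nonneg hq', sub_add_cancel,
      AddMonoidAlgebra.coeff_smul_apply]
    rw [Int.toNat_of_nonneg hq', Pi.sub_apply, Pi.single_eq_same, sub_self, zero_add]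
    exact hp q hq

theorem laurentDeriv_symVar_of_ne {i k : Fin d} (h : k ≠ i) (n : ℕ) :
    laurentDeriv k (symVar i ^ n) = 0 := by
  induction n with
  | zero => rw [pow_zero, AddMonoidAlgebra.one_def, laurentDeriv_single]; simp
  | succ n ih =>
    rw [pow_succ, laurentDeriv_mul, ih, zero_mul, zero_add, symVar, laurentDeriv_add, monom, monom,
      laurentDeriv_single, laurentDeriv_single, Pi.single_eq_of_ne h, Pi.single_eq_of_ne h]
    simp

theorem laurentDeriv_symVar (i : Fin d) (n : ℕ) :
    laurentDeriv i (symVar i ^ (n + 1)) =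
      AddMonoidAlgebra.single 0 ((n : ℚ) + 1) *
        ((1 - monom (Pi.single i (-2))) * symVar i ^ n) := by
  have hneg : (AddMonoidAlgebra.single (Pi.single i (-2)) (-1) : LaurentPoly d) =
      -AddMonoidAlgebra.single (Pi.single i (-2)) 1 := by
    rw [eq_neg_iff_add_eq_zero, ← AddMonoidAlgebra.single_add, neg_add_cancel,
      AddMonoidAlgebra.single_zero]
  have h1 : laurentDeriv i (symVar i) = 1 - monom (Pi.single i (-2)) := by
    rw [symVar, laurentDeriv_add, monom, monom, laurentDeriv_single, laurentDeriv_single,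
      ← Pi.single_sub, ← Pi.single_sub, sub_self, Pi.single_zero, Pi.single_eq_same,
      Pi.single_eq_same, sub_eq_add_neg (1 : LaurentPoly d), monom,
      AddMonoidAlgebra.one_def, ← hneg]
    norm_num
  induction n with
  | zero =>
    rw [zero_add, pow_one, pow_zero, h1, Nat.cast_zero, zero_add, ← AddMonoidAlgebra.one_def,
      one_mul, mul_one]
  | succ n ih =>
    rw [pow_succ, laurentDeriv_mul, ih, h1]
    push_cast
    rw [AddMonoidAlgebra.single_add 0 ((n : ℚ) + 1) 1, ← AddMonoidAlgebra.one_def]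
    ring

theorem laurentDeriv_laurentSubst_of_ne {i k : Fin d} (h : k ≠ i) (f : LaurentPoly d) :
    laurentDeriv k (laurentSubst i f) = laurentSubst i (laurentDeriv k f) := by
  induction f using AddMonoidAlgebra.induction_linear with
  | zero => simp [laurentDeriv]
  | add f g hf hg => rw [map_add, laurentDeriv_add, hf, hg, laurentDeriv_add, map_add]
  | single p c =>
    have h1 : (p - Pi.single k 1 : Fin d → ℤ) i = p i := by
      rw [Pi.sub_apply, Pi.single_eq_of_ne h.symm, sub_zero]
    have h2 : (p - Pi.single i (p i) : Fin d → ℤ) k = p k := by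
      rw [Pi.sub_apply, Pi.single_eq_of_ne h, sub_zero]
    rw [laurentSubst_single, laurentDeriv_mul, laurentDeriv_symVar_of_ne h, mul_zero, add_zero,
      laurentDeriv_single, laurentDeriv_single, laurentSubst_single, h1, h2, sub_right_comm]

/-- Chain rule: x + 1/x has derivative 1 - x⁻². -/
theorem laurentDeriv_laurentSubst_self {i : Fin d} {f : LaurentPoly d}
    (hf : ∀ p, p i < 0 → f.coeff p = 0) :
    laurentDeriv i (laurentSubst i f) =
      (1 - monom (Pi.single i (-2))) * laurentSubst i (laurentDeriv i f) := by
  refine laurentPoly_support_induction (motive := fun f => laurentDeriv i (laurentSubst i f) =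
      (1 - monom (Pi.single i (-2))) * laurentSubst i (laurentDeriv i f)) f
    (by simp [laurentDeriv])
    (fun f g h h' => by rw [map_add, laurentDeriv_add, h, h', laurentDeriv_add, map_add, mul_add])
    fun p hp c => ?_
  obtain ⟨k, hk⟩ := Int.eq_ofNat_of_zero_le (not_lt.1 fun h => hp (hf p h))
  have h2 : (p - Pi.single i (p i) : Fin d → ℤ) i = 0 := by
    rw [Pi.sub_apply, Pi.single_eq_same, sub_self]
  have h0 : laurentDeriv i (AddMonoidAlgebra.single (p - Pi.single i (p i)) c) = 0 := by
    rw [laurentDeriv_single, h2]; simp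
  rw [laurentSubst_single, laurentDeriv_mul, h0, zero_mul, zero_add, laurentDeriv_single,
    laurentSubst_single]
  rcases k with _ | k
  · rw [hk]
    simp [laurentDeriv, AddMonoidAlgebra.one_def]
  · have h3 : (p - Pi.single i 1 : Fin d → ℤ) i = (k : ℤ) := by
      rw [Pi.sub_apply, Pi.single_eq_same, hk]; push_cast; ring
    have h4 : p - Pi.single i 1 - Pi.single i (k : ℤ) = p - Pi.single i (p i) := by
      rw [sub_sub, ← Pi.single_add, hk]; push_cast; rw [add_comm]
    rw [h3, h4, hk, Int.toNat_natCast, Int.toNat_natCast, laurentDeriv_symVar, ← hk]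
    have h5 : AddMonoidAlgebra.single (p - Pi.single i (p i)) ((p i : ℚ) * c) =
        AddMonoidAlgebra.single (0 : Fin d → ℤ) ((k : ℚ) + 1) *
          AddMonoidAlgebra.single (p - Pi.single i (p i)) c := by
      rw [AddMonoidAlgebra.single_mul_single, zero_add, hk]; push_cast; rfl
    rw [h5]
    ring

/-- The substitution of `xᵢ + 1 / xᵢ` for `xᵢ` in a series. -/
def walkSubst (i : Fin d) (F : WalkSeries d) : WalkSeries d :=
  PowerSeries.mk fun n => laurentSubst i (PowerSeries.coeff n F)

/-- The series without negative powers of `xᵢ`. -/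
def IsPolynomialIn (i : Fin d) (F : WalkSeries d) : Prop :=
  ∀ n p, p i < 0 → walkCoeff F n p = 0

theorem IsPolynomialIn.walkDeriv {i : Fin d} {F : WalkSeries d} (hF : IsPolynomialIn i F)
    (u : Option (Fin d)) : IsPolynomialIn i (walkDeriv u F) := by
  intro n p hp
  rw [walkDeriv_apply]
  rcases u with _ | k
  · rw [walkCoeff_partialDeriv_none, hF _ p hp, mul_zero]
  · rw [walkCoeff_partialDeriv_some]
    by_cases hk : k = i
    · subst hk
      by_cases h1 : p k = -1
      · rw [h1]; simp
      · rw [hF n, mul_zero]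
        rw [Pi.add_apply, Pi.single_eq_same]; omega
    · rw [hF n, mul_zero]
      rw [Pi.add_apply, Pi.single_eq_of_ne (Ne.symm hk)]; omega

theorem IsPolynomialIn.iterate_walkDeriv {i : Fin d} {F : WalkSeries d} (hF : IsPolynomialIn i F)
    (u : Option (Fin d)) (m : ℕ) : IsPolynomialIn i ((LatticeWalks.walkDeriv u)^[m] F) := by
  induction m with
  | zero => exact hF
  | succ m ih => rw [Function.iterate_succ_apply']; exact ih.walkDeriv u

theorem IsPolynomialIn.smul {i : Fin d} {F : WalkSeries d} (hF : IsPolynomialIn i F)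
    (f : PolyRing d) : IsPolynomialIn i (f • F) := by
  induction f using polyRing_induction with
  | const c => intro n p hp; rw [C_smul, walkCoeff_smul, hF n p hp, mul_zero]
  | add f g hf hg => intro n p hp; rw [add_smul, walkCoeff_add, hf n p hp, hg n p hp, add_zero]
  | mul f u hf =>
    intro n p hp
    rw [mul_smul]
    rcases u with _ | k
    · cases n with
      | zero => rw [walkCoeff_X_none_smul_zero]
      | succ n => rw [walkCoeff_X_none_smul_succ, hf n p hp]
    · rw [walkCoeff_X_some_smul, hf]
      rw [Pi.sub_apply]
      by_cases hk : i = k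
      · subst hk; rw [Pi.single_eq_same]; omega
      · rw [Pi.single_eq_of_ne hk]; omega

theorem isPolynomialIn_one (i : Fin d) : IsPolynomialIn i (1 : WalkSeries d) := by
  intro n p hp
  rw [walkCoeff, PowerSeries.coeff_one]
  split_ifs
  · rw [AddMonoidAlgebra.one_def, AddMonoidAlgebra.coeff_single, Finsupp.single_eq_of_ne]
    rintro rfl
    simp at hp
  · simp

theorem isPolynomialIn_algebraMap (i : Fin d) (f : PolyRing d) :
    IsPolynomialIn i (algebraMap (PolyRing d) (WalkSeries d) f) := by
  rw [Algebra.algebraMap_eq_smul_one]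
  exact (isPolynomialIn_one i).smul f

theorem walkSubst_add (i : Fin d) (F G : WalkSeries d) :
    walkSubst i (F + G) = walkSubst i F + walkSubst i G :=
  PowerSeries.ext fun n => by simp [walkSubst]

theorem walkSubst_zero (i : Fin d) : walkSubst i (0 : WalkSeries d) = 0 :=
  PowerSeries.ext fun n => by simp [walkSubst]

theorem walkSubst_C (i : Fin d) (f : LaurentPoly d) :
    walkSubst i (PowerSeries.C f) = PowerSeries.C (laurentSubst i f) :=
  PowerSeries.ext fun n => by
    rw [walkSubst, PowerSeries.coeff_mk, PowerSeries.coeff_C, PowerSeries.coeff_C]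
    split_ifs <;> simp

theorem walkSubst_mul {i : Fin d} {F G : WalkSeries d} (hF : IsPolynomialIn i F)
    (hG : IsPolynomialIn i G) : walkSubst i (F * G) = walkSubst i F * walkSubst i G := by
  ext1 n
  simp only [walkSubst, PowerSeries.coeff_mk, PowerSeries.coeff_mul, map_sum]
  exact Finset.sum_congr rfl fun j _ => laurentSubst_mul (hF j.1) (hG j.2)

/-- In a nonzero coefficient of t^n, a monomial of maximal degree in xᵢ keeps its coefficient. -/
theorem walkSubst_ne_zero {i : Fin d} {F : WalkSeries d} (hF : IsPolynomialIn i F) (h0 : F ≠ 0) :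
    walkSubst i F ≠ 0 := by
  obtain ⟨n, hn⟩ : ∃ n, PowerSeries.coeff n F ≠ 0 := by
    by_contra! h
    exact h0 (PowerSeries.ext fun n => by rw [h n, map_zero])
  have hne : (PowerSeries.coeff n F).coeff.support.Nonempty := by
    rw [Finsupp.support_nonempty_iff]
    exact fun h => hn (AddMonoidAlgebra.coeff_eq_zero.1 h)
  obtain ⟨p, hp, hmax⟩ := Finset.exists_max_image _ (fun p : Fin d → ℤ => p i) hne
  intro h
  have h1 := coeff_laurentSubst (hF n) p fun q hq => hmax q (Finsupp.mem_support_iff.2 hq)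
  have h2 : laurentSubst i (PowerSeries.coeff n F) = 0 := by
    rw [← PowerSeries.coeff_mk n fun n => laurentSubst i (PowerSeries.coeff n F)]
    change PowerSeries.coeff n (walkSubst i F) = 0
    rw [h, map_zero]
  rw [h2] at h1
  exact Finsupp.mem_support_iff.1 hp h1.symm

/-- Substitution turns a polynomial into a Laurent polynomial in xᵢ, hence into a rational series.
-/
theorem walkSubst_algebraMap_mem (i : Fin d) (f : PolyRing d) :
    walkSubst i (algebraMap (PolyRing d) (WalkSeries d) f) ∈
      saturation (Submodule.span (PolyRing d) {(1 : WalkSeries d)}) := by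
  have hone : (1 : WalkSeries d) ∈
      saturation (Submodule.span (PolyRing d) {(1 : WalkSeries d)}) := mem_saturation_span rfl
  have hC : ∀ g : LaurentPoly d, PowerSeries.C g ∈
      saturation (Submodule.span (PolyRing d) {(1 : WalkSeries d)}) := fun g => by
    simpa using C_mul_mem_saturation hone g
  induction f using polyRing_induction with
  | const c =>
    have h : algebraMap (PolyRing d) (WalkSeries d) (MvPolynomial.C c) =
        PowerSeries.C (AddMonoidAlgebra.single 0 c) := by
      refine walkSeries_ext fun n p => ?_
      rw [algebraMap_polyRing_apply, MvPolynomial.aeval_C, Algebra.algebraMap_eq_smul_one,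
        walkCoeff_smul, ← mul_one (PowerSeries.C _), walkCoeff_C_mul,
        AddMonoidAlgebra.coeff_single_mul_apply, neg_zero, zero_add, walkCoeff]
    rw [h, walkSubst_C]
    exact hC _
  | add f g hf hg => rw [map_add, walkSubst_add]; exact add_mem hf hg
  | mul f u hf =>
    rw [map_mul, walkSubst_mul (isPolynomialIn_algebraMap i _) (isPolynomialIn_algebraMap i _)]
    refine mul_mem_saturation ?_ hf
    rw [algebraMap_polyRing_apply, MvPolynomial.aeval_X]
    rcases u with _ | k
    · have h : walkSubst i (variableSeries (none : Option (Fin d))) =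
          (MvPolynomial.X none : PolyRing d) • 1 := by
        rw [X_smul, mul_one]
        ext1 n
        rw [walkSubst, PowerSeries.coeff_mk, variableSeries, PowerSeries.coeff_X]
        split_ifs
        · rw [← monom_zero, laurentSubst_monom_of_eq_zero rfl]
        · exact map_zero _
      rw [h]
      exact Submodule.smul_mem _ _ hone
    · rw [variableSeries, walkSubst_C]
      exact hC _

theorem walkSubst_smul {i : Fin d} {F : WalkSeries d} (hF : IsPolynomialIn i F) (f : PolyRing d) :
    walkSubst i (f • F) =
      walkSubst i (algebraMap (PolyRing d) (WalkSeries d) f) * walkSubst i F := by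
  rw [smul_eq_algebraMap_mul, walkSubst_mul (isPolynomialIn_algebraMap i f) hF]

/-- The factor is 1, except 1 - xᵢ⁻² for the derivative in xᵢ. It does not depend on F, so it is the
same for all the iterated derivatives. -/
theorem exists_walkDeriv_walkSubst (i : Fin d) (u : Option (Fin d)) :
    ∃ g : LaurentPoly d, ∀ F : WalkSeries d, IsPolynomialIn i F →
      walkDeriv u (walkSubst i F) = PowerSeries.C g * walkSubst i (walkDeriv u F) := by
  rcases u with _ | k
  · refine ⟨1, fun F _ => ?_⟩
    rw [map_one, one_mul]
    ext1 n
    have h : ∀ f : LaurentPoly d, f * ((n : LaurentPoly d) + 1) = (n + 1) • f := fun f => by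
      rw [nsmul_eq_mul, mul_comm]; push_cast; rfl
    simp only [walkDeriv_apply, partialDeriv, walkSubst, PowerSeries.coeff_derivative,
      PowerSeries.coeff_mk, h, map_nsmul]
  · by_cases hk : k = i
    · subst hk
      refine ⟨1 - monom (Pi.single k (-2)), fun F hF => ?_⟩
      ext1 n
      simp only [walkDeriv_apply, partialDeriv, walkSubst, PowerSeries.coeff_mk,
        PowerSeries.coeff_C_mul]
      exact laurentDeriv_laurentSubst_self (hF n)
    · refine ⟨1, fun F _ => ?_⟩
      rw [map_one, one_mul]
      ext1 n
      simp only [walkDeriv_apply, partialDeriv, walkSubst, PowerSeries.coeff_mk]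
      exact laurentDeriv_laurentSubst_of_ne hk _

open Classical in
/-- Substituting `xᵢ + 1 / xᵢ` for `xᵢ` preserves D-finiteness. -/
theorem isDiffFinite_walkSubst {i : Fin d} {u : Option (Fin d)} {F : WalkSeries d}
    (hF : IsPolynomialIn i F) (h : IsDiffFinite (PolyRing d) (walkDeriv u) F) :
    IsDiffFinite (PolyRing d) (walkDeriv u) (walkSubst i F) := by
  have hli := h.not_linearIndependent (isLeibniz_walkDeriv u)
  rw [linearIndependent_iff] at hli
  push Not at hli
  obtain ⟨p, hp, hp0⟩ := hli
  rw [Finsupp.linearCombination_apply] at hp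
  obtain ⟨g, hg⟩ := exists_walkDeriv_walkSubst i u
  have hne : p.support.Nonempty := Finsupp.support_nonempty_iff.2 hp0
  set r := p.support.max' hne with hr
  have hrmem : r ∈ p.support := p.support.max'_mem hne
  set S := (Finset.range r).image (fun m => walkSubst i ((walkDeriv u)^[m] F)) with hS
  have hlow : ∀ m < r, walkSubst i ((walkDeriv u)^[m] F) ∈
      saturation (Submodule.span (PolyRing d) (S : Set (WalkSeries d))) := fun m hm =>
    mem_saturation_span (Finset.mem_image.2 ⟨m, Finset.mem_range.2 hm, rfl⟩)
  have hsum : ∀ s : Finset ℕ, walkSubst i (∑ m ∈ s, p m • (walkDeriv u)^[m] F) =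
      ∑ m ∈ s, walkSubst i (algebraMap (PolyRing d) (WalkSeries d) (p m)) *
        walkSubst i ((walkDeriv u)^[m] F) := by
    intro s
    induction s using Finset.cons_induction with
    | empty => exact walkSubst_zero i
    | cons a s ha ih =>
      rw [Finset.sum_cons, Finset.sum_cons, walkSubst_add, ih,
        walkSubst_smul (hF.iterate_walkDeriv u a)]
  have hr' : walkSubst i ((walkDeriv u)^[r] F) ∈
      saturation (Submodule.span (PolyRing d) (S : Set (WalkSeries d))) := by
    -- After substitution the equation still has order r, since its leading coefficient stays
    -- nonzero.
    refine mem_saturation_of_mul (walkSubst_algebraMap_mem i (p r))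
      (walkSubst_ne_zero (isPolynomialIn_algebraMap i _) ?_) ?_
    · rw [Ne, map_eq_zero_iff _ algebraMap_polyRing_injective]
      exact Finsupp.mem_support_iff.1 hrmem
    · have h1 := hsum p.support
      rw [Finsupp.sum] at hp
      rw [hp, walkSubst_zero, ← Finset.add_sum_erase _ _ hrmem, eq_comm,
        ← eq_neg_iff_add_eq_zero] at h1
      rw [h1]
      refine neg_mem (sum_mem fun m hm =>
        mul_mem_saturation (walkSubst_algebraMap_mem i (p m)) (hlow m ?_))
      exact lt_of_le_of_ne (p.support.le_max' m (Finset.mem_of_mem_erase hm))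
        (Finset.ne_of_mem_erase hm)
  have hle : ∀ m ≤ r, walkSubst i ((walkDeriv u)^[m] F) ∈
      saturation (Submodule.span (PolyRing d) (S : Set (WalkSeries d))) := by
    intro m hm
    rcases hm.lt_or_eq with hm | rfl
    · exact hlow m hm
    · exact hr'
  refine ⟨S, hle 0 (Nat.zero_le _), fun e he => ?_⟩
  obtain ⟨m, hm, rfl⟩ := Finset.mem_image.1 he
  rw [hg _ (hF.iterate_walkDeriv u m), ← Function.iterate_succ_apply' (f := walkDeriv u)]
  exact C_mul_mem_saturation (hle _ (Finset.mem_range.1 hm)) _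

end Substitution

section Words

/-! ### Recurrence relations for walks -/

variable {d : ℕ} {α : Type*}

open Classical in
/-- The generating function of walks with labelled steps which stay in `E`. -/
def wordSeries (σ : Finset α) (step : α → Fin d → ℤ) (E : Set (Fin d → ℤ)) : WalkSeries d :=
  PowerSeries.mk fun n =>
    ∑ w ∈ Fintype.piFinset (fun _ : Fin n => σ) with StaysIn E (fun i => step (w i)),
      monom (position (fun i => step (w i)) n)

theorem laurentKeep_add (E : Set (Fin d → ℤ)) (f g : LaurentPoly d) :
    laurentKeep E (f + g) = laurentKeep E f + laurentKeep E g :=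
  laurentPoly_ext fun p => by
    simp only [coeff_laurentKeep, AddMonoidAlgebra.coeff_add, Finsupp.add_apply]
    split_ifs <;> simp

theorem laurentKeep_zero (E : Set (Fin d → ℤ)) : laurentKeep E 0 = 0 :=
  laurentPoly_ext fun p => by simp [coeff_laurentKeep]

theorem laurentKeep_sum {ι : Type*} (E : Set (Fin d → ℤ)) (s : Finset ι) (f : ι → LaurentPoly d) :
    laurentKeep E (∑ i ∈ s, f i) = ∑ i ∈ s, laurentKeep E (f i) := by
  induction s using Finset.cons_induction with
  | empty => exact laurentKeep_zero E
  | cons a s ha ih => rw [Finset.sum_cons, Finset.sum_cons, laurentKeep_add, ih]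

theorem laurentKeep_monom_mul (E : Set (Fin d → ℤ)) (q : Fin d → ℤ) (f : LaurentPoly d) :
    laurentKeep E (monom q * f) = monom q * laurentKeep {p | p + q ∈ E} f :=
  laurentPoly_ext fun p => by
    rw [coeff_monom_mul, coeff_laurentKeep, coeff_laurentKeep, coeff_monom_mul, Set.mem_ofPred_eq,
      sub_add_cancel]

open Classical in
theorem laurentKeep_single (E : Set (Fin d → ℤ)) (p : Fin d → ℤ) (c : ℚ) :
    laurentKeep E (AddMonoidAlgebra.single p c) =
      if p ∈ E then AddMonoidAlgebra.single p c else 0 :=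
  laurentPoly_ext fun q => by
    rw [coeff_laurentKeep]
    by_cases h : q = p
    · subst h; split_ifs <;> simp
    · split_ifs <;> simp [Finsupp.single_eq_of_ne h]

theorem position_snoc_of_le {n : ℕ} (w : Fin n → Fin d → ℤ) (s : Fin d → ℤ) {k : ℕ} (hk : k ≤ n) :
    position (Fin.snoc (α := fun _ => Fin d → ℤ) w s) k = position w k := by
  rw [position, position, Finset.sum_filter, Finset.sum_filter, Fin.sum_univ_castSucc]
  simp only [Fin.snoc_castSucc, Fin.val_castSucc, Fin.snoc_last, Fin.val_last]
  rw [if_neg (by omega), add_zero]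

theorem position_snoc_last {n : ℕ} (w : Fin n → Fin d → ℤ) (s : Fin d → ℤ) :
    position (Fin.snoc (α := fun _ => Fin d → ℤ) w s) (n + 1) = position w n + s := by
  rw [position, position, Finset.sum_filter, Finset.sum_filter, Fin.sum_univ_castSucc]
  simp only [Fin.snoc_castSucc, Fin.val_castSucc, Fin.snoc_last, Fin.val_last]
  rw [if_pos (by omega)]
  congr 1
  exact Finset.sum_congr rfl fun i _ => by rw [if_pos (by omega), if_pos (by omega)]

theorem staysIn_snoc {n : ℕ} (E : Set (Fin d → ℤ)) (w : Fin n → Fin d → ℤ) (s : Fin d → ℤ) :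
    StaysIn E (Fin.snoc (α := fun _ => Fin d → ℤ) w s) ↔ StaysIn E w ∧ position w n + s ∈ E := by
  constructor
  · intro h
    refine ⟨fun k hk => ?_, ?_⟩
    · rw [← position_snoc_of_le w s hk]; exact h k (by omega)
    · rw [← position_snoc_last]; exact h _ le_rfl
  · rintro ⟨h1, h2⟩ k hk
    rcases Nat.lt_or_ge n k with hk' | hk'
    · obtain rfl : k = n + 1 := by omega
      rwa [position_snoc_last]
    · rw [position_snoc_of_le w s hk']; exact h1 k hk'

theorem coeff_zero_wordSeries (σ : Finset α) (step : α → Fin d → ℤ) {E : Set (Fin d → ℤ)}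
    (hE : (0 : Fin d → ℤ) ∈ E) : PowerSeries.coeff 0 (wordSeries σ step E) = monom 0 := by
  classical
  rw [wordSeries, PowerSeries.coeff_mk, Finset.sum_filter, Fintype.piFinset_of_isEmpty,
    Finset.univ_unique, Finset.sum_singleton]
  have h : ∀ k, position (fun i : Fin 0 => step ((default : Fin 0 → α) i)) k = 0 := fun k => by
    rw [position]; simp
  rw [if_pos, h]
  exact fun k _ => by rw [h]; exact hE

/-- Removal of the last step. Only the endpoint of the longer walk remains to be tested against the
region. -/
theorem coeff_succ_wordSeries (σ : Finset α) (step : α → Fin d → ℤ) (E : Set (Fin d → ℤ)) (n : ℕ) :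
    PowerSeries.coeff (n + 1) (wordSeries σ step E) =
      laurentKeep E ((∑ a ∈ σ, monom (step a)) * PowerSeries.coeff n (wordSeries σ step E)) := by
  classical
  rw [wordSeries, PowerSeries.coeff_mk, PowerSeries.coeff_mk, Finset.sum_mul_sum,
    ← Finset.sum_product', laurentKeep_sum, Finset.sum_filter]
  have h : ∀ (w : Fin n → α) (a : α), (fun i => step (Fin.snoc (α := fun _ => α) w a i)) =
      Fin.snoc (α := fun _ => Fin d → ℤ) (fun i => step (w i)) (step a) := by
    intro w a
    exact Fin.comp_snoc step w a
  have h2 : ∀ j : α × (Fin n → α),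
      laurentKeep E (monom (step j.1) * monom (position (fun i => step (j.2 i)) n)) =
        if position (fun i => step (j.2 i)) n + step j.1 ∈ E then
          monom (position (fun i => step (j.2 i)) n + step j.1) else 0 := fun j => by
    rw [monom_mul_monom, add_comm, monom, laurentKeep_single]
  simp only [h2]
  rw [← Finset.sum_filter]
  rw [← Finset.sum_filter]
  symm
  refine Finset.sum_bij' (fun j _ => Fin.snoc (α := fun _ => α) j.2 j.1)
    (fun w _ => (w (Fin.last n), Fin.init (α := fun _ => α) w)) ?_ ?_ ?_ ?_ ?_
  · rintro ⟨a, w⟩ hj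
    simp only [Finset.mem_filter, Finset.mem_product, Fintype.mem_piFinset] at hj ⊢
    obtain ⟨⟨ha, hw, hstay⟩, hE⟩ := hj
    refine ⟨fun i => ?_, ?_⟩
    · refine Fin.lastCases ?_ (fun i => ?_) i
      · rwa [Fin.snoc_last]
      · rw [Fin.snoc_castSucc]; exact hw i
    · rw [h, staysIn_snoc]; exact ⟨hstay, hE⟩
  · intro w hw
    simp only [Finset.mem_filter, Finset.mem_product, Fintype.mem_piFinset] at hw ⊢
    obtain ⟨hw, hstay⟩ := hw
    rw [← Fin.snoc_init_self w, h, staysIn_snoc] at hstay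
    exact ⟨⟨hw _, fun i => hw _, hstay.1⟩, hstay.2⟩
  · rintro ⟨a, w⟩ _
    simp
  · intro w _
    simp
  · rintro ⟨a, w⟩ _
    rw [h, position_snoc_last]

open Classical in
theorem walkCoeff_succ_wordSeries (σ : Finset α) (step : α → Fin d → ℤ) (E : Set (Fin d → ℤ))
    (n : ℕ) (p : Fin d → ℤ) : walkCoeff (wordSeries σ step E) (n + 1) p =
      if p ∈ E then ∑ a ∈ σ, walkCoeff (wordSeries σ step E) n (p - step a) else 0 := by
  rw [walkCoeff, coeff_succ_wordSeries, coeff_laurentKeep, Finset.sum_mul,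
    AddMonoidAlgebra.coeff_sum, Finset.sum_apply']
  simp only [coeff_monom_mul, walkCoeff]

theorem walkSeries_eq_wordSeries (S : Finset (Fin d → ℤ)) (E : Set (Fin d → ℤ)) :
    walkSeries S E = wordSeries S id E := rfl

end Words

section Hadamard

/-! ### Hadamard step sets -/

variable {S : Finset (Fin 3 → ℤ)} {U V : Finset (Fin 2 → ℤ)} {T : Finset (Fin 1 → ℤ)}

theorem append_two_one (u : Fin 2 → ℤ) (t : Fin 1 → ℤ) :
    (Fin.append u t : Fin 3 → ℤ) = ![u 0, u 1, t 0] := by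
  ext i
  fin_cases i <;> rfl

theorem append_injective {u u' : Fin 2 → ℤ} {t t' : Fin 1 → ℤ}
    (h : (Fin.append u t : Fin 3 → ℤ) = Fin.append u' t') : u = u' ∧ t = t' := by
  rw [append_two_one, append_two_one] at h
  have h0 := congrFun h 0
  have h1 := congrFun h 1
  have h2 := congrFun h 2
  simp at h0 h1 h2
  constructor
  · ext i; fin_cases i <;> simpa
  · ext i; fin_cases i; simpa

/-- The two parts of S are disjoint because 0 is not in T, and concatenation is injective, so no
step is counted twice. -/
theorem IsHadamardWith.sum_eq (hS : IsHadamardWith (d := 2) (δ := 1) S U V T) {M : Type*}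
    [AddCommMonoid M] (f : (Fin 3 → ℤ) → M) :
    ∑ s ∈ S, f s = ∑ u ∈ U, f ![u 0, u 1, 0] + ∑ v ∈ V, ∑ t ∈ T, f ![v 0, v 1, t 0] := by
  classical
  have h := hS.eq_union
  have hdisj : Disjoint (U.image (fun u => (Fin.append u (0 : Fin 1 → ℤ) : Fin 3 → ℤ)))
      (Finset.image₂ (fun v t => (Fin.append v t : Fin 3 → ℤ)) V T) := by
    rw [Finset.disjoint_left]
    intro s hs hs'
    obtain ⟨u, _, rfl⟩ := Finset.mem_image.1 hs
    obtain ⟨v, _, t, ht, hvt⟩ := Finset.mem_image₂.1 hs'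
    rw [(append_injective hvt).2] at ht
    exact hS.zero_notMem_T ht
  have h' : S = U.image (fun u => (Fin.append u (0 : Fin 1 → ℤ) : Fin 3 → ℤ)) ∪
      Finset.image₂ (fun v t => (Fin.append v t : Fin 3 → ℤ)) V T := by
    convert h
  rw [h', Finset.sum_union hdisj, Finset.sum_image fun u _ u' _ h => (append_injective h).1,
    ← Finset.image_uncurry_product, Finset.sum_image, Finset.sum_product]
  · simp only [Function.uncurry_apply_pair, append_two_one, Pi.zero_apply]
  · rintro ⟨v, t⟩ _ ⟨v', t'⟩ _ h
    exact Prod.ext_iff.2 (append_injective h)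

/-- The third coordinate of a coloured step counts black steps. -/
def liftStep (a : (Fin 2 → ℤ) × Colour) : Fin 3 → ℤ := ![a.1 0, a.1 1, if a.2 then 1 else 0]

/-- The coloured steps are the disjoint union of a white copy of U and a black copy of V. -/
theorem sum_colouredSteps {M : Type*} [AddCommMonoid M] (f : (Fin 3 → ℤ) → M) :
    ∑ a ∈ colouredSteps U V, f (liftStep a) =
      ∑ u ∈ U, f ![u 0, u 1, 0] + ∑ v ∈ V, f ![v 0, v 1, 1] := by
  classical
  have h : colouredSteps U V =
      U.image (fun u => (u, Colour.white)) ∪ V.image (fun v => (v, Colour.black)) := by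
    ext ⟨s, c⟩
    simp only [colouredSteps, Finset.mem_filter, Finset.mem_product, Finset.mem_union,
      Finset.mem_univ, Finset.mem_sdiff, Finset.mem_image, Prod.mk.injEq]
    cases c <;> simp <;> tauto
  rw [h, Finset.sum_union, Finset.sum_image, Finset.sum_image]
  · simp [liftStep]
  · intro a _ b _ h; exact (Prod.ext_iff.1 h).1
  · intro a _ b _ h; exact (Prod.ext_iff.1 h).1
  · rw [Finset.disjoint_left]
    rintro a h1 h2
    obtain ⟨u, _, rfl⟩ := Finset.mem_image.1 h1
    obtain ⟨v, _, hv⟩ := Finset.mem_image.1 h2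
    have h : true = false := (Prod.ext_iff.1 hv).2
    exact absurd h (by decide)

/-- With black steps raising the third coordinate by one, the number of black steps is the final
height, and the quadrant constraint does not involve it. Coloured walks thus obey the same
recurrence as walks in dimension three. -/
theorem colouredSeries_eq_wordSeries (U V : Finset (Fin 2 → ℤ)) :
    colouredSeries U V = wordSeries (colouredSteps U V) liftStep quadrantTimesLine := by
  classical
  have hpos : ∀ {n : ℕ} (w : Fin n → (Fin 2 → ℤ) × Colour) (k : ℕ),
      position (fun i => liftStep (w i)) k = ![position (fun i => (w i).1) k 0,
        position (fun i => (w i).1) k 1, position (fun i => liftStep (w i)) k 2] := by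
    intro n w k
    ext i
    fin_cases i <;> simp [position, liftStep, Finset.sum_apply]
  have hblack : ∀ {n : ℕ} (w : Fin n → (Fin 2 → ℤ) × Colour),
      position (fun i => liftStep (w i)) n 2 = blackCount w := by
    intro n w
    rw [position, blackCount, Finset.card_filter, Finset.sum_apply,
      Finset.filter_true_of_mem fun i _ => i.2]
    push_cast
    rfl
  ext1 n
  rw [colouredSeries, wordSeries, PowerSeries.coeff_mk, PowerSeries.coeff_mk]
  have hstay : ∀ w : Fin n → (Fin 2 → ℤ) × Colour, StaysIn (orthant 2) (fun i => (w i).1) ↔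
      StaysIn quadrantTimesLine (fun i => liftStep (w i)) := by
    intro w
    refine forall₂_congr fun k _ => ?_
    rw [hpos]
    simp [orthant, quadrantTimesLine, Fin.forall_fin_two]
  simp only [hstay]
  refine Finset.sum_congr rfl fun w _ => ?_
  rw [hpos w n, hblack]
  congr 1
  exact append_two_one _ _

theorem zero_mem_quadrantTimesLine : (0 : Fin 3 → ℤ) ∈ quadrantTimesLine := ⟨le_rfl, le_rfl⟩

theorem zero_mem_orthant : (0 : Fin 3 → ℤ) ∈ orthant 3 := fun _ => le_rfl

theorem vec_mem_quadrantTimesLine (a b c : ℤ) :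
    (![a, b, c] : Fin 3 → ℤ) ∈ quadrantTimesLine ↔ 0 ≤ a ∧ 0 ≤ b := Iff.rfl

theorem vec_mem_orthant (a b c : ℤ) :
    (![a, b, c] : Fin 3 → ℤ) ∈ orthant 3 ↔ 0 ≤ a ∧ 0 ≤ b ∧ 0 ≤ c := by
  simp [orthant, Fin.forall_fin_succ]

theorem vec_sub_vec (a b c a' b' c' : ℤ) :
    (![a, b, c] : Fin 3 → ℤ) - ![a', b', c'] = ![a - a', b - b', c - c'] := by
  ext i; fin_cases i <;> rfl

theorem eq_vec (p : Fin 3 → ℤ) : p = ![p 0, p 1, p 2] := by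
  ext i; fin_cases i <;> rfl

/-! ### Recurrences for coefficients -/

theorem walkCoeff_zero_wordSeries {α : Type*} (σ : Finset α) (step : α → Fin 3 → ℤ)
    {E : Set (Fin 3 → ℤ)} (hE : (0 : Fin 3 → ℤ) ∈ E) (a b c : ℤ) :
    walkCoeff (wordSeries σ step E) 0 ![a, b, c] = if a = 0 ∧ b = 0 ∧ c = 0 then 1 else 0 := by
  rw [walkCoeff, coeff_zero_wordSeries σ step hE, monom, AddMonoidAlgebra.coeff_single]
  split_ifs with h
  · obtain ⟨rfl, rfl, rfl⟩ := h
    have : (![0, 0, 0] : Fin 3 → ℤ) = 0 := by ext i; fin_cases i <;> rfl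
    rw [this, Finsupp.single_eq_same]
  · rw [Finsupp.single_eq_of_ne]
    intro h'
    exact h ⟨congrFun h' 0, congrFun h' 1, congrFun h' 2⟩

open Classical in
theorem IsHadamardWith.walkCoeff_succ (hS : IsHadamardWith (d := 2) (δ := 1) S U V T)
    (E : Set (Fin 3 → ℤ)) (n : ℕ) (a b c : ℤ) :
    walkCoeff (walkSeries S E) (n + 1) ![a, b, c] =
      if ![a, b, c] ∈ E then
        ∑ u ∈ U, walkCoeff (walkSeries S E) n ![a - u 0, b - u 1, c] +
          ∑ v ∈ V, ∑ t ∈ T, walkCoeff (walkSeries S E) n ![a - v 0, b - v 1, c - t 0] else 0 := by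
  rw [walkSeries_eq_wordSeries, walkCoeff_succ_wordSeries]
  simp only [id_eq]
  rw [hS.sum_eq fun s => walkCoeff (wordSeries S id E) n (![a, b, c] - s)]
  simp only [vec_sub_vec, sub_zero]

theorem walkCoeff_succ_colouredSeries (U V : Finset (Fin 2 → ℤ)) (n : ℕ) (a b c : ℤ) :
    walkCoeff (colouredSeries U V) (n + 1) ![a, b, c] =
      if 0 ≤ a ∧ 0 ≤ b then
        ∑ u ∈ U, walkCoeff (colouredSeries U V) n ![a - u 0, b - u 1, c] +
          ∑ v ∈ V, walkCoeff (colouredSeries U V) n ![a - v 0, b - v 1, c - 1] else 0 := by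
  rw [colouredSeries_eq_wordSeries, walkCoeff_succ_wordSeries,
    sum_colouredSteps fun s => walkCoeff (wordSeries (colouredSteps U V) liftStep
      quadrantTimesLine) n (![a, b, c] - s)]
  simp only [vec_sub_vec, sub_zero]
  by_cases h : 0 ≤ a ∧ 0 ≤ b
  · rw [if_pos h, if_pos ((vec_mem_quadrantTimesLine a b c).2 h)]
  · rw [if_neg h, if_neg fun h' => h ((vec_mem_quadrantTimesLine a b c).1 h')]

theorem walkCoeff_zero_walkSeries (S : Finset (Fin 3 → ℤ)) {E : Set (Fin 3 → ℤ)}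
    (hE : (0 : Fin 3 → ℤ) ∈ E) (a b c : ℤ) :
    walkCoeff (walkSeries S E) 0 ![a, b, c] = if a = 0 ∧ b = 0 ∧ c = 0 then 1 else 0 :=
  walkCoeff_zero_wordSeries S id hE a b c

theorem walkCoeff_zero_colouredSeries (U V : Finset (Fin 2 → ℤ)) (a b c : ℤ) :
    walkCoeff (colouredSeries U V) 0 ![a, b, c] = if a = 0 ∧ b = 0 ∧ c = 0 then 1 else 0 := by
  rw [colouredSeries_eq_wordSeries,
    walkCoeff_zero_wordSeries _ _ zero_mem_quadrantTimesLine]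

theorem walkCoeff_colouredSeries_of_neg (U V : Finset (Fin 2 → ℤ)) (n : ℕ) (a b c : ℤ)
    (hc : c < 0) : walkCoeff (colouredSeries U V) n ![a, b, c] = 0 := by
  induction n generalizing a b c with
  | zero => rw [walkCoeff_zero_colouredSeries, if_neg (by omega)]
  | succ n ih =>
    rw [walkCoeff_succ_colouredSeries, Finset.sum_eq_zero fun u _ => ih _ _ _ hc,
      Finset.sum_eq_zero fun v _ => ih _ _ _ (by omega), add_zero, ite_self]

theorem isPolynomialIn_colouredSeries (U V : Finset (Fin 2 → ℤ)) :
    IsPolynomialIn (2 : Fin 3) (colouredSeries U V) := by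
  intro n p hp
  rw [eq_vec p]
  exact walkCoeff_colouredSeries_of_neg U V n _ _ _ hp

/-! ### The possible sets `T` and the corresponding walks -/

theorem IsHadamardWith.subset_pair (hS : IsHadamardWith (d := 2) (δ := 1) S U V T) :
    T = ∅ ∨ T = {![1]} ∨ T = {![-1]} ∨ T = {![1], ![-1]} := by
  have h : T ⊆ {![1], ![-1]} := by
    intro t ht
    rw [Finset.mem_insert, Finset.mem_singleton]
    have hext : ∀ x : ℤ, t 0 = x → t = ![x] := by
      intro x hx; ext i; fin_cases i; exact hx
    rcases hS.small_T t ht 0 with h | h | h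
    · exact Or.inr (hext _ h)
    · refine absurd ht ?_
      have : t = 0 := by ext i; fin_cases i; exact h
      rw [this]
      exact hS.zero_notMem_T
    · exact Or.inl (hext _ h)
  have h' : (T : Set (Fin 1 → ℤ)) ⊆ {![1], ![-1]} := fun t ht => by
    have := h ht
    rwa [Finset.mem_insert, Finset.mem_singleton] at this
  rcases Set.subset_pair_iff_eq.1 h' with h | h | h | h
  · exact Or.inl (Finset.coe_eq_empty.1 h)
  · exact Or.inr (Or.inl (Finset.coe_eq_singleton.1 h))
  · exact Or.inr (Or.inr (Or.inl (Finset.coe_eq_singleton.1 h)))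
  · exact Or.inr (Or.inr (Or.inr (Finset.coe_injective (h.trans Finset.coe_pair.symm))))

theorem vec_one_ne_vec_neg_one : (![1] : Fin 1 → ℤ) ≠ ![-1] := fun h => by
  have := congrFun h 0
  simp at this

/-- Heights never decrease, so the constraint on the third coordinate is automatic. -/
theorem walkSeries_of_singleton_one (hS : IsHadamardWith (d := 2) (δ := 1) S U V {![1]}) :
    walkSeries S (orthant 3) = colouredSeries U V := by
  refine walkSeries_ext fun n p => ?_
  rw [eq_vec p]
  generalize p 0 = a, p 1 = b, p 2 = c
  induction n generalizing a b c with
  | zero => rw [walkCoeff_zero_walkSeries S zero_mem_orthant, walkCoeff_zero_colouredSeries]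
  | succ n ih =>
    by_cases hc : c < 0
    · rw [walkCoeff_colouredSeries_of_neg _ _ _ _ _ _ hc, hS.walkCoeff_succ, if_neg]
      rw [vec_mem_orthant]
      omega
    · rw [hS.walkCoeff_succ, walkCoeff_succ_colouredSeries]
      simp only [Finset.sum_singleton, ih, vec_mem_orthant, Matrix.cons_val_zero]
      congr 1
      simp [not_lt.1 hc]

/-- The third coordinate starts at 0 and can never increase, so no step of V × T is allowed. The
hypothesis covers both the empty set and {-1}. -/
theorem walkSeries_of_one_notMem (hS : IsHadamardWith (d := 2) (δ := 1) S U V T)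
    (hT : ∀ t ∈ T, t 0 = -1) : walkSeries S (orthant 3) = slice 2 0 (colouredSeries U V) := by
  refine walkSeries_ext fun n p => ?_
  rw [eq_vec p]
  generalize p 0 = a, p 1 = b, p 2 = c
  have hslice : ∀ n a b c, walkCoeff (slice 2 0 (colouredSeries U V)) n ![a, b, c] =
      if c = 0 then walkCoeff (colouredSeries U V) n ![a, b, c] else 0 :=
    fun n a b c => walkCoeff_slice 2 0 _ n ![a, b, c]
  induction n generalizing a b c with
  | zero =>
    rw [walkCoeff_zero_walkSeries S zero_mem_orthant, hslice, walkCoeff_zero_colouredSeries]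
    split_ifs <;> first | rfl | omega
  | succ n ih =>
    rw [hS.walkCoeff_succ, hslice, walkCoeff_succ_colouredSeries]
    simp only [vec_mem_orthant]
    by_cases hc : 0 ≤ c
    · have h1 : ∑ v ∈ V, ∑ t ∈ T,
          walkCoeff (walkSeries S (orthant 3)) n ![a - v 0, b - v 1, c - t 0] = 0 :=
        Finset.sum_eq_zero fun v _ => Finset.sum_eq_zero fun t ht => by
          rw [ih, hslice, hT t ht, if_neg (by omega)]
      rw [h1, add_zero]
      simp only [ih, hslice]
      by_cases hc0 : c = 0
      · subst hc0
        have h2 : ∑ v ∈ V,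
            walkCoeff (colouredSeries U V) n ![a - v 0, b - v 1, 0 - 1] = 0 :=
          Finset.sum_eq_zero fun v _ =>
            walkCoeff_colouredSeries_of_neg _ _ _ _ _ _ (by omega)
        rw [h2]
        simp
      · simp [hc0]
    · rw [if_neg (by omega), if_neg (by omega)]

theorem IsHadamardWith.walkCoeff_succ_pair
    (hS : IsHadamardWith (d := 2) (δ := 1) S U V {![1], ![-1]})
    (E : Set (Fin 3 → ℤ)) [DecidablePred (· ∈ E)] (n : ℕ) (a b c : ℤ) :
    walkCoeff (walkSeries S E) (n + 1) ![a, b, c] =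
      if ![a, b, c] ∈ E then
        ∑ u ∈ U, walkCoeff (walkSeries S E) n ![a - u 0, b - u 1, c] +
          ∑ v ∈ V, (walkCoeff (walkSeries S E) n ![a - v 0, b - v 1, c - 1] +
            walkCoeff (walkSeries S E) n ![a - v 0, b - v 1, c + 1]) else 0 := by
  rw [hS.walkCoeff_succ]
  simp only [Finset.sum_pair vec_one_ne_vec_neg_one, Matrix.cons_val_zero, sub_neg_eq_add]

/-- The reflection principle. -/
theorem walkSeries_orthant_eq_nonnegPart
    (hS : IsHadamardWith (d := 2) (δ := 1) S U V {![1], ![-1]}) :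
    walkSeries S (orthant 3) =
      nonnegPart 2 ((1 - PowerSeries.C (monom ![0, 0, -1]) ^ 2) *
        walkSeries S quadrantTimesLine) := by
  classical
  set Q := walkSeries S quadrantTimesLine with hQ
  set O := walkSeries S (orthant 3) with hO
  -- The steps and the region are invariant under z ↦ 1/z.
  have hsym : ∀ n a b c, walkCoeff Q n ![a, b, c] = walkCoeff Q n ![a, b, -c] := by
    intro n
    induction n with
    | zero =>
      intro a b c
      rw [walkCoeff_zero_walkSeries S zero_mem_quadrantTimesLine,
        walkCoeff_zero_walkSeries S zero_mem_quadrantTimesLine]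
      simp only [neg_eq_zero]
    | succ n ih =>
      intro a b c
      rw [hS.walkCoeff_succ_pair, hS.walkCoeff_succ_pair]
      simp only [vec_mem_quadrantTimesLine]
      refine if_congr Iff.rfl ?_ rfl
      congr 1
      · exact Finset.sum_congr rfl fun u _ => ih _ _ _
      · refine Finset.sum_congr rfl fun v _ => ?_
        rw [add_comm, ih, ih _ _ (c - 1), neg_add', neg_sub, sub_eq_neg_add 1 c, ← hQ]
  -- The range starts at c = -1 and not at 0, because the recurrence at height 0 calls the values at
  -- height -1.
  have hrefl : ∀ n a b c, -1 ≤ c → walkCoeff O n ![a, b, c] =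
      walkCoeff Q n ![a, b, c] - walkCoeff Q n ![a, b, c + 2] := by
    intro n
    induction n with
    | zero =>
      intro a b c hc
      rw [walkCoeff_zero_walkSeries S zero_mem_quadrantTimesLine,
        walkCoeff_zero_walkSeries S zero_mem_quadrantTimesLine,
        walkCoeff_zero_walkSeries S zero_mem_orthant, if_neg (by omega : ¬ (_ ∧ _ ∧ c + 2 = 0)),
        sub_zero]
    | succ n ih =>
      intro a b c hc
      rcases hc.eq_or_lt with rfl | hc
      -- At height -1 both sides vanish: the left one by confinement, the right one because heights
      -- -1 and 1 are exchanged by the symmetry.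
      · rw [hsym (n + 1) a b (-1), hS.walkCoeff_succ_pair, vec_mem_orthant, if_neg (by omega)]
        norm_num
      · rw [hS.walkCoeff_succ_pair, hS.walkCoeff_succ_pair, hS.walkCoeff_succ_pair]
        simp only [vec_mem_orthant, vec_mem_quadrantTimesLine]
        by_cases hab : 0 ≤ a ∧ 0 ≤ b
        · rw [if_pos (by omega), if_pos hab, if_pos hab, add_sub_add_comm,
            ← Finset.sum_sub_distrib, ← Finset.sum_sub_distrib]
          congr 1
          · exact Finset.sum_congr rfl fun u _ => ih _ _ _ (by omega)
          · refine Finset.sum_congr rfl fun v _ => ?_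
            rw [← hO, ih _ _ _ (by omega), ih _ _ _ (by omega), add_sub_add_comm,
              show c - 1 + 2 = c + 2 - 1 by ring, show c + 1 + 2 = c + 2 + 1 by ring]
        · rw [if_neg (by omega), if_neg hab, if_neg hab, sub_zero]
  refine walkSeries_ext fun n p => ?_
  rw [eq_vec p, nonnegPart_eq_keep, walkCoeff_keep, sub_mul, one_mul, walkCoeff_sub, sq, ← map_mul,
    monom_mul_monom, walkCoeff_monom_mul]
  generalize p 0 = a, p 1 = b, p 2 = c
  have hv : (![a, b, c] : Fin 3 → ℤ) - (![0, 0, -1] + ![0, 0, -1]) = ![a, b, c + 2] := by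
    ext i; fin_cases i <;> simp [sub_eq_add_neg]
  rw [hv]
  by_cases hc : 0 ≤ c
  · rw [if_pos (show (![a, b, c] : Fin 3 → ℤ) ∈ {p : Fin 3 → ℤ | 0 ≤ p 2} from hc)]
    exact hrefl n a b c (by omega)
  · rw [if_neg (show (![a, b, c] : Fin 3 → ℤ) ∉ {p : Fin 3 → ℤ | 0 ≤ p 2} from hc)]
    cases n with
    | zero => rw [walkCoeff_zero_walkSeries S zero_mem_orthant, if_neg (by omega)]
    | succ n => rw [hS.walkCoeff_succ_pair, vec_mem_orthant, if_neg (by omega)]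

/-! ### The series Q as a substitution in C₁ -/

theorem laurentKeep_quadrant_mul_symVar_pow (f : LaurentPoly 3) (k : ℕ) :
    laurentKeep quadrantTimesLine (f * symVar 2 ^ k) =
      laurentKeep quadrantTimesLine f * symVar 2 ^ k := by
  have hE : ∀ x : ℤ, {p : Fin 3 → ℤ | p + Pi.single 2 x ∈ quadrantTimesLine} =
      quadrantTimesLine := by
    intro x
    ext p
    simp [quadrantTimesLine]
  induction k with
  | zero => simp
  | succ k ih =>
    rw [pow_succ, ← mul_assoc, mul_comm _ (symVar 2), symVar, add_mul, laurentKeep_add,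
      laurentKeep_monom_mul, laurentKeep_monom_mul, hE, hE, ← add_mul, ← symVar, ih]
    ring

/-- The substitution only alters the third exponent, which the region ignores. -/
theorem laurentSubst_laurentKeep_quadrant (f : LaurentPoly 3) :
    laurentSubst 2 (laurentKeep quadrantTimesLine f) =
      laurentKeep quadrantTimesLine (laurentSubst 2 f) := by
  classical
  induction f using AddMonoidAlgebra.induction_linear with
  | zero => simp [laurentKeep_zero]
  | add f g hf hg => rw [laurentKeep_add, map_add, hf, hg, map_add, laurentKeep_add]
  | single p c =>
    have h : p - Pi.single 2 (p 2) ∈ quadrantTimesLine ↔ p ∈ quadrantTimesLine := by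
      simp [quadrantTimesLine]
    rw [laurentSubst_single, laurentKeep_quadrant_mul_symVar_pow, laurentKeep_single,
      laurentKeep_single]
    simp only [h]
    split_ifs
    · rw [laurentSubst_single]
    · rw [map_zero, zero_mul]

theorem coeff_monom_of_neg {p q : Fin 3 → ℤ} (hq : 0 ≤ q 2) (hp : p 2 < 0) :
    (monom q : LaurentPoly 3).coeff p = 0 := by
  rw [monom, AddMonoidAlgebra.coeff_single, Finsupp.single_eq_of_ne]
  rintro rfl
  omega

theorem coeff_sum_colouredSteps_of_neg (U V : Finset (Fin 2 → ℤ)) (p : Fin 3 → ℤ)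
    (hp : p 2 < 0) :
    (∑ a ∈ colouredSteps U V, monom (liftStep a) : LaurentPoly 3).coeff p = 0 := by
  rw [AddMonoidAlgebra.coeff_sum, Finset.sum_apply']
  refine Finset.sum_eq_zero fun a _ => coeff_monom_of_neg ?_ hp
  change (0 : ℤ) ≤ if a.2 then 1 else 0
  split_ifs <;> norm_num

/-- Replacing v by z + 1/z turns U(x,y) + v V(x,y) into U(x,y) + (z + 1/z) V(x,y), the step
polynomial of S. -/
theorem laurentSubst_sum_colouredSteps
    (hS : IsHadamardWith (d := 2) (δ := 1) S U V {![1], ![-1]}) :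
    laurentSubst 2 (∑ a ∈ colouredSteps U V, monom (liftStep a) : LaurentPoly 3) =
      ∑ s ∈ S, monom s := by
  rw [sum_colouredSteps fun s => (monom s : LaurentPoly 3),
    hS.sum_eq fun s => (monom s : LaurentPoly 3), map_add, map_sum, map_sum]
  congr 1
  · exact Finset.sum_congr rfl fun u _ => laurentSubst_monom_of_eq_zero rfl
  · refine Finset.sum_congr rfl fun v _ => ?_
    have h1 : ∀ x : ℤ, (monom ![v 0, v 1, x] : LaurentPoly 3) =
        monom ![v 0, v 1, 0] * monom (Pi.single 2 x) := by
      intro x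
      rw [monom_mul_monom]
      congr 1
      ext i; fin_cases i <;> simp
    rw [Finset.sum_pair vec_one_ne_vec_neg_one, Matrix.cons_val_zero, Matrix.cons_val_zero,
      h1 1, h1 (-1), ← mul_add, ← symVar,
      laurentSubst_mul (fun p hp => coeff_monom_of_neg le_rfl hp)
        (fun p hp => coeff_monom_of_neg (by rw [Pi.single_eq_same]; norm_num) hp),
      laurentSubst_monom_single, laurentSubst_monom_of_eq_zero rfl]

/-- Both sides satisfy the same recurrence in the length, because the substitution is multiplicative
on nonnegative exponents and commutes with the restriction to the region. -/
theorem walkSubst_colouredSeries (hS : IsHadamardWith (d := 2) (δ := 1) S U V {![1], ![-1]}) :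
    walkSubst 2 (colouredSeries U V) = walkSeries S quadrantTimesLine := by
  have hpoly := isPolynomialIn_colouredSeries U V
  rw [colouredSeries_eq_wordSeries] at hpoly ⊢
  ext1 n
  rw [walkSubst, PowerSeries.coeff_mk, walkSeries_eq_wordSeries]
  induction n with
  | zero =>
    rw [coeff_zero_wordSeries _ _ zero_mem_quadrantTimesLine,
      coeff_zero_wordSeries _ _ zero_mem_quadrantTimesLine, laurentSubst_monom_of_eq_zero rfl]
  | succ n ih =>
    rw [coeff_succ_wordSeries, coeff_succ_wordSeries, laurentSubst_laurentKeep_quadrant, ← ih,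
      laurentSubst_mul (coeff_sum_colouredSteps_of_neg U V) (hpoly n),
      laurentSubst_sum_colouredSteps hS]
    rfl

/-! ### Conclusion by cases on `T` -/

theorem eq_pair_of_charPoly_eq (hS : IsHadamardWith (d := 2) (δ := 1) S U V T)
    (h : charPoly T = monom ![1] + monom ![-1]) : T = {![1], ![-1]} := by
  have hcoeff : ∀ p, (charPoly T).coeff p = if p ∈ T then 1 else 0 := by
    intro p
    rw [charPoly, AddMonoidAlgebra.coeff_sum, Finset.sum_apply']
    simp [monom, Finsupp.single_apply]
  have h1 : ![1] ∈ T := by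
    by_contra hn
    have := hcoeff ![1]
    rw [h, if_neg hn] at this
    simp [monom] at this
  have h2 : ![-1] ∈ T := by
    by_contra hn
    have := hcoeff ![-1]
    rw [h, if_neg hn] at this
    simp [monom] at this
  rcases hS.subset_pair with rfl | rfl | rfl | rfl
  · simp at h1
  · exact absurd (Finset.mem_singleton.1 h2).symm vec_one_ne_vec_neg_one
  · exact absurd (Finset.mem_singleton.1 h1) vec_one_ne_vec_neg_one
  · rfl

theorem isDFinite_walkSeries_orthant (hS : IsHadamardWith (d := 2) (δ := 1) S U V T)
    (h : IsDFinite (colouredSeries U V)) : IsDFinite (walkSeries S (orthant 3)) := by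
  have hslice : (∀ t ∈ T, t 0 = -1) → IsDFinite (walkSeries S (orthant 3)) := by
    intro hT
    rw [walkSeries_of_one_notMem hS hT]
    refine isDFinite_of_isDiffFinite fun u => ?_
    by_cases hu : u = some 2
    · subst hu; exact isDiffFinite_slice_self 2 0 _
    · exact isDiffFinite_slice hu (h.isDiffFinite _) (h.isDiffFinite u) 0
  rcases hS.subset_pair with rfl | rfl | rfl | rfl
  · exact hslice (by simp)
  · rw [walkSeries_of_singleton_one hS]; exact h
  · exact hslice (by simp)
  -- O is obtained from C₁ by substitution, multiplication by the Laurent polynomial 1 - z⁻² and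
  -- extraction of the nonnegative part, each of which preserves D-finiteness.
  · rw [walkSeries_orthant_eq_nonnegPart hS, ← walkSubst_colouredSeries hS,
      show (1 - PowerSeries.C (monom ![0, 0, -1]) ^ 2 : WalkSeries 3) =
        PowerSeries.C (1 - monom ![0, 0, -1] ^ 2) by rw [map_sub, map_one, map_pow]]
    exact isDFinite_of_isDiffFinite (isDiffFinite_nonnegPart 2 fun u =>
      isDiffFinite_C_mul (isDiffFinite_walkSubst (isPolynomialIn_colouredSeries U V)
        (h.isDiffFinite u)) _)

end Hadamard

end LatticeWalks

end

open LatticeWalks in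
theorem mainTheorem6 (S : Finset (Fin 3 → ℤ)) (U V : Finset (Fin 2 → ℤ))
    (T : Finset (Fin 1 → ℤ)) (hS : IsHadamardWith (d := 2) (δ := 1) S U V T) :
    (IsDFinite (colouredSeries U V) → IsDFinite (walkSeries S (orthant 3))) ∧
    (charPoly T = monom ![1] + monom ![-1] →
      walkSeries S (orthant 3) =
        nonnegPart 2 ((1 - PowerSeries.C (monom ![0, 0, -1]) ^ 2) *
          walkSeries S quadrantTimesLine)) := by
  refine ⟨isDFinite_walkSeries_orthant hS, fun hT => ?_⟩
  obtain rfl := eq_pair_of_charPoly_eq hS hT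
  exact walkSeries_orthant_eq_nonnegPart hS
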